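/- **Setting.** Let $\mathcal G$ be a finite directed graph with an input node $\iota$ and an output node $o\neq\iota$, such that every node is downstream from $\iota$ and upstream from $o$ (a core input-output network). *Admissible systems.* These are $\dot X=f(X,\mathcal I)$ with one real variable $x_j$ per node, $f$ smooth, the parameter $\mathcal I$ occurring only in $f_\iota$, and $f_{j,\ell}=\partial f_j/\partial x_\ell\equiv 0$ precisely when $\ell\ne j$ and there is no arrow $\ell\to j$. If $X_0$ is a hyperbolic equilibrium at $\mathcal I_0$, with family of equilibria $X(\mathcal I)$, $X(\mathcal I_0)=X_0$, then a node $\kappa$ is *homeostatic* if $x_\kappa'(\mathcal I_0)=0$. *Induction.* The homeostasis matrix $H$ is the Jacobian matrix $(f_{j,\ell})$ without the row of $\iota$ and the column of $o$. A *homeostasis block* $B$ is an irreducible square diagonal block in a block upper triangular form $PHQ$ ($P,Q$ permutation matrices; zeros mean entries that vanish identically). Its *homeostasis subnetwork* $\mathcal K$ is the set of nodes that index its rows or columns. $\mathcal K$ *induces* a node $\kappa$ ($\mathcal K\Rightarrow\kappa$) if generically (on an open dense subset, in the $C^\infty$ topology) among the admissible $f$ with a hyperbolic equilibrium at $(X_0,\mathcal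 I_0)$, with $o$ homeostatic there and $\det B=0$ there, the node $\kappa$ is homeostatic. $\mathcal K$ induces a set of nodes if it induces each of them. *Structural part.* A node is *simple* if it lies on a simple (non-repeating) path from $\iota$ to $o$, *appendage* if not, and *super-simple* if it lies on every simple path from $\iota$ to $o$. The super-simple nodes $\iota=\rho_0\prec\rho_1\prec\dots\prec\rho_{q+1}=o$ are ordered by their appearance on these paths. For $1\le j\le q+1$ let $\mathcal L_j''$ be the set of simple nodes strictly between $\rho_{j-1}$ and $\rho_j$. For a simple path $S$ from $\iota$ to $o$ let $C_S$ be the subnetwork on the nodes outside $S$. An appendage node $\tau$ is *super-appendage* if for every $S$ the transitive (strong) component of $\tau$ in $C_S$ consists of appendage nodes only. Let $T_j$ be the set of appendage, not super-appendage, nodes $\tau$ such that for some $S$ the transitive component of $\tau$ in $C_S$ contains a node of $\mathcal L_j''$ and consists of $\tau$, nodes of $\mathcal L_j''$, and appendage nodes that are not super-appendage. Put $\mathcal L_j'=\mathcal L_j''\cup T_j$ and $\mathcal L_j=\{\rho_{j-1}\}\cup\mathcal L_j'\cup\{\rho_j\}$ (the structural subnetwork). The *structural pattern network* $\mathcal P_{\mathcal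 S}$ is $$\rho_0\to\tilde{\mathcal L}_1\to\rho_1\to\tilde{\mathcal L}_2\to\cdots\to\tilde{\mathcal L}_{q+1}\to\rho_{q+1},$$ where the *backbone node* $\tilde{\mathcal L}_j$ stands for $\mathcal L_j'$ (possibly empty). *Appendage part.* The *appendage components* $\tilde{\mathcal A}$ (the nodes of the appendage pattern network $\mathcal P_{\mathcal A}$) are the transitive components of the subnetwork of super-appendage nodes. An *appendage path* is a simple path that contains an appendage node and all of whose nodes, except perhaps the two end points, are appendage. $\mathcal V_{min}(\tilde{\mathcal A})$ is the most upstream node $\mathcal V$ of $\mathcal P_{\mathcal S}$ that contains a simple node from which there is an appendage path to a node of $\tilde{\mathcal A}$. A backbone node $\tilde{\mathcal L}_j$ *induces* an appendage component $\tilde{\mathcal A}$ if $\mathcal L_j$ (which is a homeostasis subnetwork) induces the set of nodes of $\tilde{\mathcal A}$. **Theorem.** For every $(X_0,\mathcal I_0)$, every $1\le j\le q+1$ and every appendage component $\tilde{\mathcal A}$: the node $\mathcal V_{min}(\tilde{\mathcal A})$ exists and is unique, and $$\tilde{\mathcal L}_j\Rightarrow\tilde{\mathcal A}\quad\Longleftrightarrow\quad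 \mathcal V_{min}(\tilde{\mathcal A})\text{ is strictly downstream from }\tilde{\mathcal L}_j\text{ in }\mathcal P_{\mathcal S}.$$ That is, $\tilde{\mathcal L}_j$ induces every appendage component whose $\mathcal V_{min}$ is strictly downstream from it, and no other appendage component. -/

import Mathlib

open scoped ContDiff

/-- An input-output network on the node set `V`: a directed graph (`Adj a b` means that there is
an arrow `a → b`) with a distinguished input node and a distinguished, different, output node. -/
structure IONetwork (V : Type*) where
  Adj : V → V → Prop
  input : V
  output : V
  input_ne_output : input ≠ output

namespace IONetwork

section Combinatorics

variable {V : Type*} (G : IONetwork V)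

/-- `G` is a core network: every node is downstream from the input node and upstream from the
output node. -/
def IsCore : Prop :=
  ∀ v, Relation.ReflTransGen G.Adj G.input v ∧ Relation.ReflTransGen G.Adj v G.output

/-- `p` is the list of nodes of a simple (directed, non-repeating) path from `a` to `b`. -/
def IsSimplePath (p : List V) (a b : V) : Prop :=
  p.head? = some a ∧ p.getLast? = some b ∧ p.IsChain G.Adj ∧ p.Nodup

/-- Simple path from the input node to the output node. -/
def IsIOPath (p : List V) : Prop := G.IsSimplePath p G.input G.output

def IsSimple (v : V) : Prop := ∃ p, G.IsIOPath p ∧ v ∈ p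

def IsAppendage (v : V) : Prop := ¬ G.IsSimple v

def IsSuperSimple (v : V) : Prop := G.IsSimple v ∧ ∀ p, G.IsIOPath p → v ∈ p

/-- The ordering `a ≺ b` of simple nodes. For a non-repeating list `p`, the condition
`[a, b].Sublist p` says that `a` and `b` lie on `p` and that `a` comes strictly before `b`. -/
def Prec (a b : V) : Prop :=
  ∃ p, G.IsIOPath p ∧
    ((G.IsSuperSimple a ∧ [a, b].Sublist p) ∨
     (G.IsSuperSimple b ∧ [a, b].Sublist p) ∨
     ∃ ρ, G.IsSuperSimple ρ ∧ [a, ρ, b].Sublist p)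

/-- `ρ ≺ ρ'` are consecutive super-simple nodes. -/
def Consecutive (ρ ρ' : V) : Prop :=
  G.IsSuperSimple ρ ∧ G.IsSuperSimple ρ' ∧ G.Prec ρ ρ' ∧
    ¬ ∃ ρ'', G.IsSuperSimple ρ'' ∧ G.Prec ρ ρ'' ∧ G.Prec ρ'' ρ'

/-- The transitive (strong) component of `a` in the subnetwork of `G` whose nodes are those in
`N` and whose arrows are all the arrows of `G` between them. -/
def transComponent (N : Set V) (a : V) : Set V :=
  {b | a ∈ N ∧ b ∈ N ∧
    Relation.ReflTransGen (fun x y => x ∈ N ∧ y ∈ N ∧ G.Adj x y) a b ∧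
    Relation.ReflTransGen (fun x y => x ∈ N ∧ y ∈ N ∧ G.Adj x y) b a}

/-- The nodes of the complementary subnetwork of the path `S`. -/
def complementary (S : List V) : Set V := {v | v ∉ S}

def IsSuperAppendage (τ : V) : Prop :=
  G.IsAppendage τ ∧ ∀ S, G.IsIOPath S → τ ∈ complementary S →
    ∀ x ∈ G.transComponent (complementary S) τ, G.IsAppendage x

/-- The simple subnetwork between the consecutive super-simple nodes `ρ` and `ρ'`. -/
def simpleSubnetwork (ρ ρ' : V) : Set V :=
  {σ | G.IsSimple σ ∧ G.Prec ρ σ ∧ G.Prec σ ρ'}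

/-- The appendage nodes linked to the simple subnetwork between `ρ` and `ρ'`: the appendage nodes
`τ`, not super-appendage, whose transitive component in some complementary subnetwork is made up
of `τ`, nodes (at least one) of the simple subnetwork, and appendage nodes that are not
super-appendage. -/
def linkedAppendage (ρ ρ' : V) : Set V :=
  {τ | G.IsAppendage τ ∧ ¬ G.IsSuperAppendage τ ∧
    ∃ S, G.IsIOPath S ∧ τ ∈ complementary S ∧
      (∃ x ∈ G.transComponent (complementary S) τ, x ∈ G.simpleSubnetwork ρ ρ') ∧
      ∀ x ∈ G.transComponent (complementary S) τ,
        x = τ ∨ x ∈ G.simpleSubnetwork ρ ρ' ∨ (G.IsAppendage x ∧ ¬ G.IsSuperAppendage x)}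

/-- The augmented simple subnetwork `L'` between `ρ` and `ρ'`. -/
def augmentedSubnetwork (ρ ρ' : V) : Set V :=
  G.simpleSubnetwork ρ ρ' ∪ G.linkedAppendage ρ ρ'

/-- The structural subnetwork `L` between `ρ` and `ρ'`. -/
def structuralSubnetwork (ρ ρ' : V) : Set V :=
  {ρ} ∪ G.augmentedSubnetwork ρ ρ' ∪ {ρ'}

/-- The nodes of the structural pattern network: the super-simple nodes, and one backbone node for
each pair of consecutive super-simple nodes. -/
inductive StructNode (G : IONetwork V) : Type _
  | super (ρ : V) (h : G.IsSuperSimple ρ) : StructNode G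
  | backbone (ρ ρ' : V) (h : G.Consecutive ρ ρ') : StructNode G

/-- The arrows `ρ → L̃ → ρ'` of the structural pattern network. -/
inductive StructArrow (G : IONetwork V) : StructNode G → StructNode G → Prop
  | enter (ρ ρ' : V) (h : G.Consecutive ρ ρ') :
      StructArrow G (StructNode.super ρ h.1) (StructNode.backbone ρ ρ' h)
  | leave (ρ ρ' : V) (h : G.Consecutive ρ ρ') :
      StructArrow G (StructNode.backbone ρ ρ' h) (StructNode.super ρ' h.2.1)

/-- `W` is strictly downstream from `W₀` in the structural pattern network. -/
def StrictlyDownstream (W₀ W : StructNode G) : Prop :=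
  Relation.TransGen (StructArrow G) W₀ W

/-- The nodes of the network that a node of the structural pattern network stands for. -/
def StructNode.carrier {G : IONetwork V} : StructNode G → Set V
  | StructNode.super ρ _ => {ρ}
  | StructNode.backbone ρ ρ' _ => G.augmentedSubnetwork ρ ρ'

/-- The appendage components: the transitive components of the subnetwork of super-appendage
nodes. -/
def IsAppendageComponent (A : Set V) : Prop :=
  ∃ τ, G.IsSuperAppendage τ ∧ A = G.transComponent {x | G.IsSuperAppendage x} τ

/-- `p` is an appendage path from `a` to `b`. -/
def IsAppendagePath (p : List V) (a b : V) : Prop :=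
  G.IsSimplePath p a b ∧ (∃ x ∈ p, G.IsAppendage x) ∧
    ∀ x ∈ p, x ≠ a → x ≠ b → G.IsAppendage x

/-- Some simple node of `W` has an appendage path to an appendage node of `A`. -/
def Feeds (W : StructNode G) (A : Set V) : Prop :=
  ∃ σ ∈ W.carrier, G.IsSimple σ ∧ ∃ τ ∈ A, G.IsAppendage τ ∧ ∃ p, G.IsAppendagePath p σ τ

/-- `W` is `V_min(A)`: the most upstream node of the structural pattern network that feeds `A`. -/
def IsVmin (A : Set V) (W : StructNode G) : Prop :=
  G.Feeds W A ∧ ∀ W', G.Feeds W' A → W' = W ∨ G.StrictlyDownstream W W'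

/-- `f_l` may enter the equation of node `j`: there is an arrow `l → j`, or `l = j` (each node is
coupled to itself). -/
def Couples (l j : V) : Prop := l = j ∨ G.Adj l j

/-- The submatrix with rows `R` and columns `C` of the homeostasis matrix is irreducible: it
cannot be brought by permutations to a block triangular form with two nonempty square diagonal
blocks, that is, it has no block of structural zeros of size `s × (n - s)` with `0 < s < n`. -/
def IsIrreducibleBlock (R C : Set V) : Prop :=
  R.Nonempty ∧ R.ncard = C.ncard ∧
    ∀ R' ⊆ R, ∀ C' ⊆ C, R'.Nonempty → C'.Nonempty → R'.ncard + C'.ncard = R.ncard →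
      ∃ j ∈ R', ∃ l ∈ C', G.Couples l j

/-- `R` and `C` are the rows and the columns of a homeostasis block. The homeostasis matrix has a
row for each node but the input node and a column for each node but the output node. The functions
`r` and `c` sort its rows and its columns into blocks (level `m` is the `m`-th block) such that the
diagonal blocks are square and the entries below them vanish identically; the homeostasis block
is one of the diagonal blocks, and irreducible. -/
def IsHomeostasisBlock (R C : Set V) : Prop :=
  ∃ (r c : V → ℕ) (k : ℕ),
    (∀ m, {j | j ≠ G.input ∧ r j = m}.ncard = {l | l ≠ G.output ∧ c l = m}.ncard) ∧
    (∀ j l, j ≠ G.input → l ≠ G.output → c l < r j → ¬ G.Couples l j) ∧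
    R = {j | j ≠ G.input ∧ r j = k} ∧ C = {l | l ≠ G.output ∧ c l = k} ∧
    G.IsIrreducibleBlock R C

end Combinatorics

section Dynamics

variable {V : Type*} [Fintype V] [DecidableEq V]

/-- The Jacobian matrix `f_{j,l} = ∂f_j/∂x_l` (row `j`, column `l`) with respect to the state
variables, at the point `z = (X, I)`. -/
noncomputable def stateJacobian (F : (V → ℝ) × ℝ → (V → ℝ)) (z : (V → ℝ) × ℝ) : Matrix V V ℝ :=
  Matrix.of fun j l => fderiv ℝ F z (Pi.single l 1, 0) j

/-- The admissible systems `dX/dt = f(X, I)` of the network: smooth families in which the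
parameter `I` occurs only in the equation of the input node, and `f_{j,l}` vanishes identically
precisely when `l` is not coupled to `j`. -/
structure AdmissibleSystem (G : IONetwork V) where
  toFun : (V → ℝ) × ℝ → (V → ℝ)
  smooth : ContDiff ℝ ∞ toFun
  param_input_only : ∀ j, j ≠ G.input → ∀ x I I', toFun (x, I) j = toFun (x, I') j
  jacobian_zero_iff : ∀ j l, (∀ z, stateJacobian toFun z j l = 0) ↔ ¬ G.Couples l j

variable {G : IONetwork V}

/-- The `k`-th derivative of an admissible system, as a continuous map. -/
noncomputable def AdmissibleSystem.jet (k : ℕ) (f : AdmissibleSystem G) :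
    C((V → ℝ) × ℝ, ContinuousMultilinearMap ℝ (fun _ : Fin k => (V → ℝ) × ℝ) (V → ℝ)) :=
  ⟨iteratedFDeriv ℝ k f.toFun,
    f.smooth.continuous_iteratedFDeriv (by exact_mod_cast le_top)⟩

/-- The `C^∞` topology: uniform convergence on compact sets of all derivatives. -/
noncomputable instance : TopologicalSpace (AdmissibleSystem G) :=
  ⨅ k : ℕ, TopologicalSpace.induced (AdmissibleSystem.jet k) inferInstance

/-- `X₀` is a hyperbolic equilibrium of `dX/dt = f(X, I₀)`. -/
def AdmissibleSystem.IsHyperbolicEquilibrium (f : AdmissibleSystem G) (X₀ : V → ℝ) (I₀ : ℝ) :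
    Prop :=
  f.toFun (X₀, I₀) = 0 ∧
    ∀ μ ∈ spectrum ℂ ((stateJacobian f.toFun (X₀, I₀)).map (algebraMap ℝ ℂ)), μ.re ≠ 0

/-- Node `κ` is (infinitesimally) homeostatic at `(X₀, I₀)`: along the family of equilibria
`X(I)` through `X₀`, the derivative of `x_κ(I)` vanishes at `I₀`. At a hyperbolic equilibrium the
family exists and is unique near `I₀` by the implicit function theorem. -/
def AdmissibleSystem.IsHomeostatic (f : AdmissibleSystem G) (X₀ : V → ℝ) (I₀ : ℝ) (κ : V) :
    Prop :=
  ∃ X : ℝ → V → ℝ, X I₀ = X₀ ∧ DifferentiableAt ℝ X I₀ ∧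
    (∀ᶠ I in nhds I₀, f.toFun (X I, I) = 0) ∧ deriv (fun I => X I κ) I₀ = 0

open Classical in
/-- The determinant of the block of the Jacobian matrix with rows `R` and columns `C` vanishes at
`(X₀, I₀)`. (Another matching `e` of columns and rows changes the determinant by a sign.) -/
def AdmissibleSystem.BlockDetVanishes (f : AdmissibleSystem G) (X₀ : V → ℝ) (I₀ : ℝ)
    (R C : Set V) : Prop :=
  ∃ e : C ≃ R,
    (Matrix.of fun i l : C => stateJacobian f.toFun (X₀, I₀) (e i) l).det = 0

/-- The admissible systems with a hyperbolic equilibrium at `(X₀, I₀)` whose output node is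
homeostatic there and for which the block with rows `R` and columns `C` is homeostasis inducing
there. -/
def inducingSystems (G : IONetwork V) (X₀ : V → ℝ) (I₀ : ℝ) (R C : Set V) :
    Set (AdmissibleSystem G) :=
  {f | f.IsHyperbolicEquilibrium X₀ I₀ ∧ f.IsHomeostatic X₀ I₀ G.output ∧
    f.BlockDetVanishes X₀ I₀ R C}

/-- `K ⇒ κ` at `(X₀, I₀)`: the node set `K` is a homeostasis subnetwork, that is, the set of nodes
of some homeostasis block, and generically (on an open dense set) among the admissible systems for
which `K` is homeostasis inducing, the node `κ` is homeostatic. -/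
def Induces (G : IONetwork V) (X₀ : V → ℝ) (I₀ : ℝ) (K : Set V) (κ : V) : Prop :=
  ∃ R C : Set V, G.IsHomeostasisBlock R C ∧ K = R ∪ C ∧
    ∃ U : Set (inducingSystems G X₀ I₀ R C), IsOpen U ∧ Dense U ∧
      ∀ f ∈ U, f.1.IsHomeostatic X₀ I₀ κ

/-- `K ⇒ N` for a set `N` of nodes. -/
def InducesSet (G : IONetwork V) (X₀ : V → ℝ) (I₀ : ℝ) (K N : Set V) : Prop :=
  ∀ κ ∈ N, G.Induces X₀ I₀ K κ

end Dynamics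

end IONetwork

/-!
The proof is organized around the set `avoiding ρ` of the nodes that can be reached
from the input node on a path that does not meet `ρ`. A node is super-simple if and only if the
output node is not in this set (`IsCore.isSuperSimple_iff`), and the sets of the super-simple nodes
form a chain, which gives the linear order of the structural pattern network
(`StructNode.strictlyDownstream_iff`). On a path from the input node to an appendage component `A`,
the part after the last simple node is an appendage path. Hence `V_min(A)` exists, and it is strictly
downstream from the backbone node between consecutive super-simple nodes `a` and `b` if and only if
no node of `A` is in `avoiding b` (`IsVmin.strictlyDownstream_iff`). It remains to show that the
structural subnetwork between `a` and `b` induces a super-appendage node `κ` if and only if `κ` is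
not in `avoiding b`.

The structural subnetwork is a homeostasis block. A simple path from the input to the output node
gives a perfect matching of the columns and rows of the homeostasis matrix, and the diagonal blocks
of its finest block triangular form are the strong components of a directed graph defined by the
matching (`MatchArrow`); they do not depend on the matching (`IsMatching.matchReach`). The columns
reachable from `a` are those of `avoiding b` (`IsMatching.matchReach_iff`), because the arrows
leaving a closed set of columns all end in one node, which is super-simple. The strong component of
`a` consists of the columns of the structural subnetwork except `b`
(`Consecutive.mem_insert_augmentedSubnetwork_iff`); the main point is that it contains no
super-appendage node (`IsSuperAppendage.not_matchReach`). No other homeostasis block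
has the same set of nodes (`IsHomeostasisBlock.eq_of_union_eq`).

If `κ` is not in `avoiding b`: the columns of `avoiding b` form a square block, which contains the
structural block as a diagonal block. If the determinant of the latter vanishes, there is a kernel
vector supported in `avoiding b`. At a hyperbolic equilibrium the derivative of the family of
equilibria is a multiple of it, so that its component at `κ` is zero (`Consecutive.isHomeostatic`);
this holds without exception.

If `κ` is in `avoiding b`: choose a tree that spans `avoiding b`. An explicit admissible system
(`treeField`) has the adjacency matrix of this tree minus the identity as its Jacobian matrix, and equilibria
that move exactly in the nodes of the tree. The block is singular since the tree does not contain
`b`, the output node is homeostatic, and `κ` is not. By Cramer's rule, `κ` fails to be homeostatic in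
a neighbourhood of this system, which meets every dense set (`Consecutive.not_induces`).
-/

namespace IONetwork

/-! ### Reachability within a set of nodes -/

section Reachability

variable {V : Type*} (G : IONetwork V)

/-- `b` can be reached from `a` along arrows of `G` between nodes of `N`; in particular both `a`
and `b` belong to `N`. -/
def ReachIn (N : Set V) (a b : V) : Prop :=
  a ∈ N ∧ b ∈ N ∧ Relation.ReflTransGen (fun x y => x ∈ N ∧ y ∈ N ∧ G.Adj x y) a b

variable {G} {N N' : Set V} {a b c : V}

theorem ReachIn.refl (ha : a ∈ N) : G.ReachIn N a a := ⟨ha, ha, .refl⟩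

theorem ReachIn.trans (h : G.ReachIn N a b) (h' : G.ReachIn N b c) : G.ReachIn N a c :=
  ⟨h.1, h'.2.1, h.2.2.trans h'.2.2⟩

theorem ReachIn.tail (h : G.ReachIn N a b) (hc : c ∈ N) (hbc : G.Adj b c) : G.ReachIn N a c :=
  ⟨h.1, hc, h.2.2.tail ⟨h.2.1, hc, hbc⟩⟩

theorem ReachIn.head (ha : a ∈ N) (hab : G.Adj a b) (h : G.ReachIn N b c) : G.ReachIn N a c :=
  ⟨ha, h.2.1, h.2.2.head ⟨ha, h.1, hab⟩⟩

theorem ReachIn.mono (h : G.ReachIn N a b) (hN : N ⊆ N') : G.ReachIn N' a b :=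
  ⟨hN h.1, hN h.2.1, Relation.ReflTransGen.mono (fun _ _ h => ⟨hN h.1, hN h.2.1, h.2.2⟩) _ _ h.2.2⟩

theorem ReachIn.mem_of_closed {X : Set V} (h : G.ReachIn N a b) (ha : a ∈ X)
    (hX : ∀ x ∈ X, ∀ y ∈ N, G.Adj x y → y ∈ X) : b ∈ X := by
  obtain ⟨-, -, h⟩ := h
  induction h with
  | refl => exact ha
  | tail _ h ih => exact hX _ ih _ h.2.1 h.2.2

theorem reachIn_univ (h : Relation.ReflTransGen G.Adj a b) : G.ReachIn Set.univ a b :=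
  ⟨trivial, trivial, Relation.ReflTransGen.mono (fun _ _ h => ⟨trivial, trivial, h⟩) _ _ h⟩

theorem mem_transComponent :
    b ∈ G.transComponent N a ↔ G.ReachIn N a b ∧ G.ReachIn N b a := by
  simp only [transComponent, ReachIn, Set.mem_ofPred_eq]
  tauto

theorem reachIn_of_isChain {p : List V} (hp : (a :: p).IsChain G.Adj)
    (hN : ∀ x ∈ a :: p, x ∈ N) (hb : b ∈ a :: p) : G.ReachIn N a b := by
  induction p generalizing a with
  | nil => simp at hb; subst hb; exact .refl (hN _ (by simp))
  | cons d p ih =>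
    rcases List.mem_cons.1 hb with rfl | hb
    · exact .refl (hN _ (by simp))
    · rw [List.isChain_cons_cons] at hp
      exact .head (hN _ (by simp)) hp.1
        (ih hp.2 (fun x hx => hN x (List.mem_cons_of_mem _ hx)) hb)

theorem reachIn_getLast_of_isChain {p : List V} (hp : p.IsChain G.Adj)
    (hN : ∀ x ∈ p, x ∈ N) (hb : b ∈ p) (hc : p.getLast? = some c) : G.ReachIn N b c := by
  obtain ⟨r₁, r₂, rfl⟩ := List.append_of_mem hb
  have h1 : (b :: r₂).IsChain G.Adj := (List.isChain_append.1 hp).2.1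
  refine reachIn_of_isChain h1 (fun x hx => hN x (by simp at hx ⊢; tauto)) ?_
  rw [List.getLast?_append_of_ne_nil _ (by simp)] at hc
  exact List.mem_of_getLast? hc

/-- A walk inside `N` can be shortened to a simple path inside `N`. -/
theorem ReachIn.exists_isSimplePath (h : G.ReachIn N a b) :
    ∃ p, G.IsSimplePath p a b ∧ ∀ x ∈ p, x ∈ N := by
  obtain ⟨ha, hb, h⟩ := h
  induction h using Relation.ReflTransGen.head_induction_on with
  | refl => exact ⟨[b], ⟨rfl, rfl, by simp, by simp⟩, by simpa using hb⟩
  | @head a c hac _ ih =>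
    obtain ⟨p, ⟨h1, h2, h3, h4⟩, hpN⟩ := ih hac.2.1
    by_cases hap : a ∈ p
    · obtain ⟨r₁, r₂, rfl⟩ := List.append_of_mem hap
      refine ⟨a :: r₂, ⟨rfl, ?_, (List.isChain_append.1 h3).2.1, (List.nodup_append.1 h4).2.1⟩,
        fun x hx => hpN x (by simp at hx ⊢; tauto)⟩
      rwa [List.getLast?_append_of_ne_nil _ (by simp)] at h2
    · obtain ⟨d, r, rfl⟩ : ∃ d r, p = d :: r := by
        cases p with
        | nil => simp at h1
        | cons d r => exact ⟨d, r, rfl⟩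
      simp only [List.head?_cons, Option.some.injEq] at h1
      subst h1
      refine ⟨a :: d :: r, ⟨rfl, ?_, ?_, ?_⟩, ?_⟩
      · simpa [List.getLast?_cons_cons] using h2
      · exact List.isChain_cons_cons.2 ⟨hac.2.2, h3⟩
      · exact List.nodup_cons.2 ⟨hap, h4⟩
      · intro x hx
        rcases List.mem_cons.1 hx with rfl | hx
        · exact ha
        · exact hpN x hx

theorem IsSimplePath.reachIn_left {p : List V} (hp : G.IsSimplePath p a b) (hc : c ∈ p)
    (hN : ∀ x ∈ p, x ∈ N) : G.ReachIn N a c := by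
  obtain ⟨h1, -, h3, -⟩ := hp
  cases p with
  | nil => simp at h1
  | cons d r =>
    simp only [List.head?_cons, Option.some.injEq] at h1
    subst h1
    exact reachIn_of_isChain h3 hN hc

theorem IsSimplePath.right_mem {p : List V} (hp : G.IsSimplePath p a b) : b ∈ p :=
  List.mem_of_getLast? hp.2.1

end Reachability

/-! ### Super-simple nodes as dominators -/

section Domination

variable {V : Type*} (G : IONetwork V)

/-- The nodes that can be reached from the input node on a path that does not meet `ρ`. (The
remaining nodes are those which, in the sense of flow graphs, are dominated by `ρ`.) -/
def avoiding (ρ : V) : Set V := {v | G.ReachIn {ρ}ᶜ G.input v}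

variable {G} {ρ ρ' v a b : V}

theorem self_notMem_avoiding : ρ ∉ G.avoiding ρ := fun h => h.2.1 rfl

theorem avoiding_input : G.avoiding G.input = ∅ :=
  Set.eq_empty_of_forall_notMem fun _ h => h.1 rfl

theorem input_mem_avoiding (h : ρ ≠ G.input) : G.input ∈ G.avoiding ρ := .refl h.symm

theorem mem_avoiding_of_sublist {p : List V} (hp : G.IsIOPath p) (h : [v, ρ].Sublist p) :
    v ∈ G.avoiding ρ := by
  obtain ⟨r₁, r₂, rfl, hv, hρ⟩ := List.cons_sublist_iff.1 h
  rw [List.singleton_sublist] at hρ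
  obtain ⟨h1, -, h3, h4⟩ := hp
  have hd := (List.nodup_append.1 h4).2.2
  cases r₁ with
  | nil => simp at hv
  | cons d r =>
    simp only [List.cons_append, List.head?_cons, Option.some.injEq] at h1
    subst h1
    refine reachIn_of_isChain (List.isChain_append.1 h3).1 (fun x hx => ?_) hv
    exact hd x hx ρ hρ

theorem reachIn_output_of_sublist {p : List V} (hp : G.IsIOPath p) (h : [ρ, v].Sublist p) :
    G.ReachIn {ρ}ᶜ v G.output := by
  obtain ⟨r₁, r₂, rfl, hρ, hv⟩ := List.cons_sublist_iff.1 h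
  rw [List.singleton_sublist] at hv
  obtain ⟨-, h2, h3, h4⟩ := hp
  have hd := (List.nodup_append.1 h4).2.2
  refine reachIn_getLast_of_isChain (List.isChain_append.1 h3).2.1
    (fun x hx => (hd ρ hρ x hx).symm) hv ?_
  rwa [List.getLast?_append_of_ne_nil _ (List.ne_nil_of_mem hv)] at h2

theorem sublist_or_sublist_of_mem {p : List V} (ha : a ∈ p) (hb : b ∈ p) (hab : a ≠ b) :
    [a, b].Sublist p ∨ [b, a].Sublist p := by
  obtain ⟨r₁, r₂, rfl⟩ := List.append_of_mem ha
  rw [List.mem_append, List.mem_cons] at hb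
  rcases hb with hb | hb | hb
  · exact .inr (List.cons_sublist_iff.2 ⟨r₁, _, rfl, hb, by simp⟩)
  · exact absurd hb.symm hab
  · refine .inl (List.cons_sublist_iff.2 ⟨r₁ ++ [a], r₂, by simp, by simp, by simpa using hb⟩)

theorem IsCore.exists_isIOPath (hG : G.IsCore) : ∃ p, G.IsIOPath p := by
  obtain ⟨p, hp, -⟩ := (reachIn_univ (hG G.output).1).exists_isSimplePath
  exact ⟨p, hp⟩

/-- The super-simple nodes are the dominators of the output node. -/
theorem IsCore.isSuperSimple_iff (hG : G.IsCore) :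
    G.IsSuperSimple ρ ↔ G.output ∉ G.avoiding ρ := by
  constructor
  · intro h ho
    obtain ⟨p, hp, hN⟩ := ReachIn.exists_isSimplePath ho
    exact hN ρ (h.2 p hp) rfl
  · intro h
    have key : ∀ p, G.IsIOPath p → ρ ∈ p := by
      intro p hp
      by_contra hρ
      exact h (hp.reachIn_left hp.right_mem fun x hx hxρ => hρ (hxρ ▸ hx))
    obtain ⟨p, hp⟩ := hG.exists_isIOPath
    exact ⟨⟨p, hp, key p hp⟩, key⟩

theorem IsSuperSimple.output_notMem (h : G.IsSuperSimple ρ) : G.output ∉ G.avoiding ρ := by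
  intro ho
  obtain ⟨p, hp, hN⟩ := ReachIn.exists_isSimplePath ho
  exact hN ρ (h.2 p hp) rfl

theorem IsCore.isSuperSimple_input (hG : G.IsCore) : G.IsSuperSimple G.input :=
  hG.isSuperSimple_iff.2 (by simp [avoiding_input])

theorem IsCore.isSuperSimple_output (hG : G.IsCore) : G.IsSuperSimple G.output :=
  hG.isSuperSimple_iff.2 self_notMem_avoiding

theorem IsSuperSimple.not_reachIn_output (h : G.IsSuperSimple ρ) (hv : v ∈ G.avoiding ρ) :
    ¬ G.ReachIn {ρ}ᶜ v G.output := fun h' => h.output_notMem (hv.trans h')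

/-- A simple node different from the super-simple node `ρ` lies either before or after `ρ`. -/
theorem IsSuperSimple.sublist_iff_left (h : G.IsSuperSimple ρ) {p : List V} (hp : G.IsIOPath p)
    (hv : v ∈ p) : [ρ, v].Sublist p ↔ v ≠ ρ ∧ v ∉ G.avoiding ρ := by
  constructor
  · intro hs
    refine ⟨?_, fun hv => h.not_reachIn_output hv (reachIn_output_of_sublist hp hs)⟩
    rintro rfl
    exact (reachIn_output_of_sublist hp hs).1 rfl
  · rintro ⟨h1, h2⟩
    exact (sublist_or_sublist_of_mem (h.2 p hp) hv h1.symm).resolve_right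
      fun hs => h2 (mem_avoiding_of_sublist hp hs)

theorem IsSuperSimple.sublist_iff_right (h : G.IsSuperSimple ρ) {p : List V} (hp : G.IsIOPath p)
    (hv : v ∈ p) : [v, ρ].Sublist p ↔ v ∈ G.avoiding ρ := by
  constructor
  · exact mem_avoiding_of_sublist hp
  · intro hm
    have hne : v ≠ ρ := by rintro rfl; exact self_notMem_avoiding hm
    exact (sublist_or_sublist_of_mem hv (h.2 p hp) hne).resolve_right
      fun hs => h.not_reachIn_output hm (reachIn_output_of_sublist hp hs)

theorem prec_iff_left (ha : G.IsSuperSimple a) (hb : G.IsSimple b) :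
    G.Prec a b ↔ b ≠ a ∧ b ∉ G.avoiding a := by
  constructor
  · rintro ⟨p, hp, h⟩
    have hs : [a, b].Sublist p := by
      rcases h with h | h | ⟨ρ, -, h⟩
      · exact h.2
      · exact h.2
      · exact List.Sublist.trans (by simp) h
    exact (ha.sublist_iff_left hp (hs.subset (by simp))).1 hs
  · intro h
    obtain ⟨p, hp, hbp⟩ := hb
    exact ⟨p, hp, .inl ⟨ha, (ha.sublist_iff_left hp hbp).2 h⟩⟩

theorem prec_iff_right (hb : G.IsSuperSimple b) (ha : G.IsSimple a) :
    G.Prec a b ↔ a ∈ G.avoiding b := by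
  constructor
  · rintro ⟨p, hp, h⟩
    have hs : [a, b].Sublist p := by
      rcases h with h | h | ⟨ρ, -, h⟩
      · exact h.2
      · exact h.2
      · exact List.Sublist.trans (by simp) h
    exact (hb.sublist_iff_right hp (hs.subset (by simp))).1 hs
  · intro h
    obtain ⟨p, hp, hap⟩ := ha
    exact ⟨p, hp, .inr (.inl ⟨hb, (hb.sublist_iff_right hp hap).2 h⟩)⟩

theorem IsSuperSimple.mem_or_mem (ha : G.IsSuperSimple a) (hb : G.IsSuperSimple b) (hab : a ≠ b) :
    a ∈ G.avoiding b ∨ b ∈ G.avoiding a := by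
  obtain ⟨p, hp, hap⟩ := ha.1
  exact (sublist_or_sublist_of_mem hap (hb.2 p hp) hab).imp
    (mem_avoiding_of_sublist hp) (mem_avoiding_of_sublist hp)

theorem IsSuperSimple.notMem_of_mem (ha : G.IsSuperSimple a) (hb : G.IsSuperSimple b)
    (hab : a ∈ G.avoiding b) : b ∉ G.avoiding a := by
  obtain ⟨p, hp, hap⟩ := ha.1
  exact ((ha.sublist_iff_left hp (hb.2 p hp)).1 ((hb.sublist_iff_right hp hap).2 hab)).2

theorem IsSuperSimple.avoiding_subset (ha : G.IsSuperSimple a) (hb : G.IsSuperSimple b)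
    (hab : a ∈ G.avoiding b) : G.avoiding a ⊆ G.avoiding b := by
  intro v hv
  have hbi : b ≠ G.input := by rintro rfl; simp [avoiding_input] at hab
  refine (ReachIn.mem_of_closed (X := G.avoiding a ∩ G.avoiding b) hv
    ⟨input_mem_avoiding fun h => ?_, input_mem_avoiding hbi⟩ ?_).2
  · exact hv.1 h.symm
  · rintro x ⟨h1, h2⟩ y hy hxy
    have hya : y ∈ G.avoiding a := h1.tail hy hxy
    refine ⟨hya, h2.tail ?_ hxy⟩
    rintro rfl
    exact ha.notMem_of_mem hb hab hya

theorem consecutive_iff : G.Consecutive a b ↔ G.IsSuperSimple a ∧ G.IsSuperSimple b ∧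
    a ∈ G.avoiding b ∧ ∀ c, G.IsSuperSimple c → a ∈ G.avoiding c → c ∉ G.avoiding b := by
  unfold Consecutive
  constructor
  · rintro ⟨ha, hb, h, hn⟩
    refine ⟨ha, hb, (prec_iff_right hb ha.1).1 h, fun c hc h1 h2 => hn ⟨c, hc, ?_, ?_⟩⟩
    · exact (prec_iff_right hc ha.1).2 h1
    · exact (prec_iff_right hb hc.1).2 h2
  · rintro ⟨ha, hb, h, hn⟩
    refine ⟨ha, hb, (prec_iff_right hb ha.1).2 h, ?_⟩
    rintro ⟨c, hc, h1, h2⟩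
    exact hn c hc ((prec_iff_right hc ha.1).1 h1) ((prec_iff_right hb hc.1).1 h2)

theorem mem_simpleSubnetwork (ha : G.IsSuperSimple a) (hb : G.IsSuperSimple b) :
    v ∈ G.simpleSubnetwork a b ↔
      G.IsSimple v ∧ v ≠ a ∧ v ∉ G.avoiding a ∧ v ∈ G.avoiding b := by
  constructor
  · rintro ⟨h, h1, h2⟩
    have := (prec_iff_left ha h).1 h1
    exact ⟨h, this.1, this.2, (prec_iff_right hb h).1 h2⟩
  · rintro ⟨h, h1, h2, h3⟩
    exact ⟨h, (prec_iff_left ha h).2 ⟨h1, h2⟩, (prec_iff_right hb h).2 h3⟩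

end Domination

/-! ### Appendage paths and appendage components -/

section AppendageComponents

variable {V : Type*} {G : IONetwork V} {v : V}

/-- On a path from the input node to an appendage node, the part after the last simple node is an
appendage path. -/
theorem exists_isAppendagePath (hG : G.IsCore) {N : Set V} (hv : G.IsAppendage v)
    (h : G.ReachIn N G.input v) :
    ∃ σ, G.IsSimple σ ∧ G.ReachIn N G.input σ ∧ ∃ p, G.IsAppendagePath p σ v := by
  have key : G.IsSimple v ∨ ∃ σ, G.IsSimple σ ∧ G.ReachIn N G.input σ ∧
      G.ReachIn ({x | G.IsAppendage x} ∪ {σ}) σ v := by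
    refine ReachIn.mem_of_closed (X := {v | G.IsSimple v ∨ ∃ σ, G.IsSimple σ ∧
      G.ReachIn N G.input σ ∧ G.ReachIn ({x | G.IsAppendage x} ∪ {σ}) σ v} ∩
      {v | G.ReachIn N G.input v}) h ⟨.inl hG.isSuperSimple_input.1, .refl h.1⟩ ?_ |>.1
    rintro x ⟨hx, hx'⟩ y hy hxy
    refine ⟨?_, hx'.tail hy hxy⟩
    by_cases hys : G.IsSimple y
    · exact .inl hys
    refine .inr ?_
    by_cases hxs : G.IsSimple x
    · exact ⟨x, hxs, hx', .tail (.refl (.inr rfl)) (.inl hys) hxy⟩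
    · obtain ⟨σ, h1, h2, h3⟩ := hx.resolve_left hxs
      exact ⟨σ, h1, h2, h3.tail (.inl hys) hxy⟩
  obtain ⟨σ, h1, h2, h3⟩ := key.resolve_left hv
  obtain ⟨p, hp, hpN⟩ := h3.exists_isSimplePath
  exact ⟨σ, h1, h2, p, hp, ⟨v, hp.right_mem, hv⟩, fun x hx hxσ _ => (hpN x hx).resolve_right hxσ⟩

variable {A : Set V}

theorem IsAppendageComponent.isAppendage (hA : G.IsAppendageComponent A) (hv : v ∈ A) :
    G.IsAppendage v := by
  obtain ⟨τ, -, rfl⟩ := hA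
  exact (mem_transComponent.1 hv).1.2.1.1

theorem IsAppendageComponent.nonempty (hA : G.IsAppendageComponent A) : A.Nonempty := by
  obtain ⟨τ, hτ, rfl⟩ := hA
  exact ⟨τ, mem_transComponent.2 ⟨.refl hτ, .refl hτ⟩⟩

end AppendageComponents

/-! ### The order of the structural pattern network -/

section PatternNetwork

variable {V : Type*} [Finite V] {G : IONetwork V} {a b c v : V}

variable (G) in
/-- The number of super-simple nodes upstream from `a`. -/
noncomputable def superRank (a : V) : ℕ := {s | G.IsSuperSimple s ∧ s ∈ G.avoiding a}.ncard

theorem superRank_lt (ha : G.IsSuperSimple a) (hb : G.IsSuperSimple b) (h : a ∈ G.avoiding b) :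
    G.superRank a < G.superRank b := by
  refine Set.ncard_lt_ncard ⟨fun s hs => ⟨hs.1, ha.avoiding_subset hb h hs.2⟩, fun hs => ?_⟩
    (Set.toFinite _)
  exact self_notMem_avoiding (hs (⟨ha, h⟩ : a ∈ {s | G.IsSuperSimple s ∧ s ∈ G.avoiding b})).2

theorem superRank_lt_iff (ha : G.IsSuperSimple a) (hb : G.IsSuperSimple b) :
    G.superRank a < G.superRank b ↔ a ∈ G.avoiding b := by
  refine ⟨fun h => ?_, superRank_lt ha hb⟩
  have hab : a ≠ b := by rintro rfl; exact lt_irrefl _ h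
  exact (ha.mem_or_mem hb hab).resolve_right fun h' => (superRank_lt hb ha h').not_gt h

theorem superRank_injective (ha : G.IsSuperSimple a) (hb : G.IsSuperSimple b)
    (h : G.superRank a = G.superRank b) : a = b := by
  by_contra hab
  rcases ha.mem_or_mem hb hab with h' | h'
  · exact (superRank_lt ha hb h').ne h
  · exact (superRank_lt hb ha h').ne' h

theorem Consecutive.superRank_lt (h : G.Consecutive a b) : G.superRank a < G.superRank b :=
  IONetwork.superRank_lt h.1 h.2.1 (consecutive_iff.1 h).2.2.1

theorem Consecutive.superRank_le (h : G.Consecutive a b) (hc : G.IsSuperSimple c)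
    (hac : G.superRank a < G.superRank c) : G.superRank b ≤ G.superRank c := by
  by_contra! hcb
  exact (consecutive_iff.1 h).2.2.2 c hc ((superRank_lt_iff h.1 hc).1 hac)
    ((superRank_lt_iff hc h.2.1).1 hcb)

theorem exists_consecutive (ha : G.IsSuperSimple a) (hb : G.IsSuperSimple b)
    (hab : G.superRank a < G.superRank b) : ∃ c, G.Consecutive a c := by
  obtain ⟨c, ⟨hc, hac⟩, hmin⟩ := Set.exists_min_image
    {c | G.IsSuperSimple c ∧ G.superRank a < G.superRank c} G.superRank (Set.toFinite _)
    ⟨b, hb, hab⟩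
  refine ⟨c, consecutive_iff.2 ⟨ha, hc, (superRank_lt_iff ha hc).1 hac, fun d hd had hdc => ?_⟩⟩
  exact (hmin d ⟨hd, superRank_lt ha hd had⟩).not_gt (superRank_lt hd hc hdc)

/-- The position of a node in the structural pattern network, which is a directed path. Only the
order of the values matters. -/
noncomputable def StructNode.rank : G.StructNode → ℕ
  | .super a _ => 2 * G.superRank a
  | .backbone a _ _ => 2 * G.superRank a + 1

theorem reflTransGen_super (ha : G.IsSuperSimple a) (hb : G.IsSuperSimple b)
    (h : G.superRank a ≤ G.superRank b) :
    Relation.ReflTransGen (StructArrow G) (.super a ha) (.super b hb) := by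
  induction hn : G.superRank b - G.superRank a using Nat.strong_induction_on generalizing a with
  | _ n ih =>
    rcases h.eq_or_lt with h | h
    · obtain rfl := superRank_injective ha hb h
      exact .refl
    · obtain ⟨c, hc⟩ := exists_consecutive ha hb h
      have h1 := hc.superRank_le hb h
      have h2 := hc.superRank_lt
      exact .head (.enter a c hc) (.head (.leave a c hc) (ih _ (by omega) hc.2.1 h1 rfl))

theorem StructNode.rank_lt_of_arrow {W W' : G.StructNode} (h : StructArrow G W W') :
    W.rank < W'.rank := by
  cases h with
  | enter a b h => simp [rank]
  | leave a b h => have := h.superRank_lt; simp [rank]; omega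

/-- The structural pattern network is linearly ordered. -/
theorem StructNode.strictlyDownstream_iff {W W' : G.StructNode} :
    G.StrictlyDownstream W W' ↔ W.rank < W'.rank := by
  constructor
  · intro h
    induction h with
    | single h => exact rank_lt_of_arrow h
    | tail _ h ih => exact ih.trans (rank_lt_of_arrow h)
  · intro h
    cases W with
    | super a ha =>
      cases W' with
      | super b hb =>
        simp only [rank] at h
        obtain ⟨c, hc⟩ := exists_consecutive ha hb (by omega)
        exact .trans_left (.head (.enter a c hc) (.single (.leave a c hc)))
          (reflTransGen_super hc.2.1 hb (hc.superRank_le hb (by omega)))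
      | backbone b b' hb =>
        simp only [rank] at h
        exact .tail' (reflTransGen_super ha hb.1 (by omega)) (.enter b b' hb)
    | backbone a a' ha =>
      cases W' with
      | super b hb =>
        simp only [rank] at h
        exact .head' (.leave a a' ha)
          (reflTransGen_super ha.2.1 hb (ha.superRank_le hb (by omega)))
      | backbone b b' hb =>
        simp only [rank] at h
        exact .head' (.leave a a' ha) (.tail
          (reflTransGen_super ha.2.1 hb.1 (ha.superRank_le hb.1 (by omega))) (.enter b b' hb))

theorem StructNode.rank_injective : Function.Injective (StructNode.rank (G := G)) := by
  intro W W' h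
  cases W with
  | super a ha =>
    cases W' with
    | super b hb =>
      simp only [rank] at h
      obtain rfl := superRank_injective ha hb (by omega)
      rfl
    | backbone b b' hb => simp only [rank] at h; omega
  | backbone a a' ha =>
    cases W' with
    | super b hb => simp only [rank] at h; omega
    | backbone b b' hb =>
      simp only [rank] at h
      obtain rfl := superRank_injective ha.1 hb.1 (by omega)
      obtain rfl := superRank_injective ha.2.1 hb.2.1 (le_antisymm
        (ha.superRank_le hb.2.1 hb.superRank_lt) (hb.superRank_le ha.2.1 ha.superRank_lt))
      rfl

/-- Every simple node is super-simple or lies between two consecutive super-simple nodes. -/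
theorem IsCore.exists_mem_carrier (hG : G.IsCore) (hv : G.IsSimple v) :
    ∃ W : G.StructNode, v ∈ W.carrier := by
  by_cases hs : G.IsSuperSimple v
  · exact ⟨.super v hs, rfl⟩
  have hvo : v ∈ G.avoiding G.output := by
    obtain ⟨p, hp, hvp⟩ := hv
    refine (hG.isSuperSimple_output.sublist_iff_right hp hvp).1 ?_
    refine (sublist_or_sublist_of_mem hvp hp.right_mem ?_).resolve_right fun h => ?_
    · rintro rfl; exact hs hG.isSuperSimple_output
    · exact (reachIn_output_of_sublist hp h).2.1 rfl
  obtain ⟨c, ⟨hc, hvc⟩, hmin⟩ := Set.exists_min_image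
    {c | G.IsSuperSimple c ∧ v ∈ G.avoiding c} G.superRank (Set.toFinite _)
    ⟨_, hG.isSuperSimple_output, hvo⟩
  obtain ⟨a, ⟨ha, hva⟩, hmax⟩ := Set.exists_max_image
    {a | G.IsSuperSimple a ∧ v ∉ G.avoiding a} G.superRank (Set.toFinite _)
    ⟨_, hG.isSuperSimple_input, by simp [avoiding_input]⟩
  have hac : a ∈ G.avoiding c := by
    refine (ha.mem_or_mem hc ?_).resolve_right fun h => hva (hc.avoiding_subset ha h hvc)
    rintro rfl; exact hva hvc
  have hcons : G.Consecutive a c := by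
    refine consecutive_iff.2 ⟨ha, hc, hac, fun d hd had hdc => ?_⟩
    by_cases hvd : v ∈ G.avoiding d
    · exact (hmin d ⟨hd, hvd⟩).not_gt (superRank_lt hd hc hdc)
    · exact (hmax d ⟨hd, hvd⟩).not_gt (superRank_lt ha hd had)
  refine ⟨.backbone a c hcons, .inl ((mem_simpleSubnetwork ha hc).2 ⟨hv, ?_, hva, hvc⟩)⟩
  rintro rfl; exact hs ha

theorem StructNode.mem_avoiding_iff {W : G.StructNode} (hb : G.IsSuperSimple b)
    (hvW : v ∈ W.carrier) (hv : G.IsSimple v) :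
    v ∈ G.avoiding b ↔ W.rank < 2 * G.superRank b := by
  cases W with
  | super a ha =>
    obtain rfl : v = a := hvW
    rw [← superRank_lt_iff ha hb, rank]; omega
  | backbone a a' ha =>
    obtain hvW | hvW : v ∈ _ ∪ _ := hvW
    · rw [mem_simpleSubnetwork ha.1 ha.2.1] at hvW
      obtain ⟨-, -, h1, h2⟩ := hvW
      simp only [rank]
      constructor
      · intro h
        by_contra! hlt
        rcases (show G.superRank b ≤ G.superRank a by omega).eq_or_lt with h' | h'
        · obtain rfl := superRank_injective hb ha.1 h'
          exact h1 h
        · exact h1 (hb.avoiding_subset ha.1 ((superRank_lt_iff hb ha.1).1 h') h)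
      · intro h
        rcases (ha.superRank_le hb (by omega)).eq_or_lt with h' | h'
        · obtain rfl := superRank_injective ha.2.1 hb h'
          exact h2
        · exact ha.2.1.avoiding_subset hb ((superRank_lt_iff ha.2.1 hb).1 h') h2
    · exact absurd hv hvW.1

variable {A : Set V}

theorem IsVmin.rank_le {W W' : G.StructNode} (h : G.IsVmin A W) (h' : G.Feeds W' A) :
    W.rank ≤ W'.rank := by
  rcases h.2 W' h' with rfl | h
  · exact le_rfl
  · exact (StructNode.strictlyDownstream_iff.1 h).le

theorem IsCore.exists_feeds_of_reachIn (hG : G.IsCore) (hA : G.IsAppendageComponent A) {N : Set V}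
    (hv : v ∈ A) (h : G.ReachIn N G.input v) :
    ∃ W : G.StructNode, G.Feeds W A ∧ ∃ σ ∈ W.carrier, G.IsSimple σ ∧ G.ReachIn N G.input σ := by
  obtain ⟨σ, hσ, hσN, p, hp⟩ := exists_isAppendagePath hG (hA.isAppendage hv) h
  obtain ⟨W, hW⟩ := hG.exists_mem_carrier hσ
  exact ⟨W, ⟨σ, hW, hσ, v, hv, hA.isAppendage hv, p, hp⟩, σ, hW, hσ, hσN⟩

theorem IsCore.existsUnique_isVmin (hG : G.IsCore) (hA : G.IsAppendageComponent A) :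
    ∃! W : G.StructNode, G.IsVmin A W := by
  have hne : {n | ∃ W : G.StructNode, G.Feeds W A ∧ W.rank = n}.Nonempty := by
    obtain ⟨v, hv⟩ := hA.nonempty
    obtain ⟨W, hW, -⟩ := hG.exists_feeds_of_reachIn hA hv (reachIn_univ (hG v).1)
    exact ⟨_, W, hW, rfl⟩
  obtain ⟨W, hW, hr⟩ := Nat.sInf_mem hne
  refine ⟨W, ⟨hW, fun W' hW' => ?_⟩, fun W' hW' => ?_⟩
  · have hle : W.rank ≤ W'.rank := hr ▸ Nat.sInf_le ⟨W', hW', rfl⟩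
    rcases hle.eq_or_lt with h | h
    · exact .inl (StructNode.rank_injective h.symm)
    · exact .inr (StructNode.strictlyDownstream_iff.2 h)
  · exact StructNode.rank_injective
      (le_antisymm (hW'.rank_le hW) (hr ▸ Nat.sInf_le ⟨W', hW'.1, rfl⟩))

/-- `V_min(A)` is strictly downstream from the backbone node between `a` and `b` if and only if
every path from the input node to `A` passes through `b`. -/
theorem IsVmin.strictlyDownstream_iff (hG : G.IsCore) (hA : G.IsAppendageComponent A)
    {W : G.StructNode} (hW : G.IsVmin A W) (h : G.Consecutive a b) :
    G.StrictlyDownstream (.backbone a b h) W ↔ ∀ v ∈ A, v ∉ G.avoiding b := by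
  have hb := h.2.1
  have hrank : 2 * G.superRank b ≤ W.rank ↔ G.StrictlyDownstream (.backbone a b h) W := by
    rw [StructNode.strictlyDownstream_iff]
    have := h.superRank_lt
    refine ⟨fun h' => by simp only [StructNode.rank] at h' ⊢; omega, fun h' => ?_⟩
    cases W with
    | super c hc =>
      simp only [StructNode.rank] at h' ⊢
      have := h.superRank_le hc (by omega)
      omega
    | backbone c c' hc =>
      simp only [StructNode.rank] at h' ⊢
      have := h.superRank_le hc.1 (by omega)
      omega
  rw [← hrank]
  constructor
  · intro hle v hv hvb
    obtain ⟨W', hW', σ, hσ, hσs, hσb⟩ := hG.exists_feeds_of_reachIn hA hv hvb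
    have h1 := (StructNode.mem_avoiding_iff hb hσ hσs).1 hσb
    have h2 := hW.rank_le hW'
    omega
  · intro hall
    by_contra! hlt
    obtain ⟨σ, hσ, hσs, τ, hτ, hτa, p, hp, -, hpa⟩ := hW.1
    have hσb := (StructNode.mem_avoiding_iff hb hσ hσs).2 hlt
    refine hall τ hτ (ReachIn.trans hσb (hp.reachIn_left hp.right_mem fun x hx hxb => ?_))
    obtain rfl : x = b := hxb
    refine hpa x hx ?_ ?_ hb.1
    · rintro rfl; exact self_notMem_avoiding hσb
    · rintro rfl; exact hτa hb.1

end PatternNetwork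

/-! ### Matchings of the homeostasis matrix -/

section Matching

variable {V : Type*} (G : IONetwork V)

/-- A perfect matching of the columns and the rows of the homeostasis matrix in positions that do
not vanish identically: column `l` is matched with row `σ l`. There is neither a column for the
output node nor a row for the input node; the convention `σ output = input` makes the matching a
permutation of the nodes. -/
def IsMatching (σ : Equiv.Perm V) : Prop :=
  σ G.output = G.input ∧ ∀ l, l ≠ G.output → G.Couples l (σ l)

/-- The position in column `l` and in the row matched with column `m` does not vanish identically.
The homeostasis blocks are the strong components of this relation. -/
def MatchArrow (σ : Equiv.Perm V) (l m : V) : Prop := m ≠ G.output ∧ G.Couples l (σ m)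

/-- The reflexive transitive closure of `MatchArrow`. -/
def MatchReach (σ : Equiv.Perm V) : V → V → Prop := Relation.ReflTransGen (G.MatchArrow σ)

variable {G} {σ σ' : Equiv.Perm V} {a b l m v : V} {X : Set V}

theorem MatchReach.trans (h : G.MatchReach σ a b) (h' : G.MatchReach σ b v) :
    G.MatchReach σ a v := Relation.ReflTransGen.trans h h'

theorem MatchReach.refl : G.MatchReach σ a a := Relation.ReflTransGen.refl

theorem MatchReach.mem_of_closed (h : G.MatchReach σ a b) (ha : a ∈ X)
    (hX : ∀ x ∈ X, ∀ y, G.MatchArrow σ x y → y ∈ X) : b ∈ X := by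
  induction h with
  | refl => exact ha
  | tail _ h ih => exact hX _ ih _ h

theorem MatchReach.ne_output (h : G.MatchReach σ a b) (ha : a ≠ G.output) : b ≠ G.output :=
  h.mem_of_closed (X := {x | x ≠ G.output}) ha fun _ _ _ h => h.1

theorem IsMatching.apply_ne_input (hσ : G.IsMatching σ) (h : l ≠ G.output) : σ l ≠ G.input :=
  fun h' => h (σ.injective (h'.trans hσ.1.symm))

theorem IsMatching.mem_image (hσ : G.IsMatching σ)
    (hX : ∀ x ∈ X, ∀ y, G.MatchArrow σ x y → y ∈ X) (hl : l ∈ X) (hm : G.Couples l m)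
    (hmi : m ≠ G.input) : m ∈ σ '' X := by
  refine ⟨σ.symm m, hX l hl _ ⟨fun h => hmi ?_, by simpa using hm⟩, by simp⟩
  rw [← hσ.1, ← h, Equiv.apply_symm_apply]

variable [Finite V]

/-- Reachability does not depend on the matching. Indeed, a set `X` of columns is closed under
`MatchArrow` if and only if its columns vanish outside of as many rows as `X` has elements. -/
theorem IsMatching.matchReach (hσ : G.IsMatching σ) (hσ' : G.IsMatching σ')
    (h : G.MatchReach σ' l m) (hl : l ≠ G.output) : G.MatchReach σ l m := by
  set X : Set V := {m | G.MatchReach σ l m}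
  have hX : ∀ x ∈ X, ∀ y, G.MatchArrow σ x y → y ∈ X := fun x hx y hxy =>
    Relation.ReflTransGen.tail hx hxy
  have hXo : ∀ x ∈ X, x ≠ G.output := fun x hx => MatchReach.ne_output hx hl
  have hsub : σ' '' X ⊆ σ '' X := by
    rintro _ ⟨x, hx, rfl⟩
    exact hσ.mem_image hX hx (hσ'.2 x (hXo x hx)) (hσ'.apply_ne_input (hXo x hx))
  have heq : σ' '' X = σ '' X := by
    refine Set.eq_of_subset_of_ncard_le hsub ?_ (Set.toFinite _)
    rw [Set.ncard_image_of_injective _ σ.injective, Set.ncard_image_of_injective _ σ'.injective]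
  refine h.mem_of_closed (X := X) MatchReach.refl fun x hx y hxy => ?_
  have : σ' y ∈ σ' '' X := heq ▸ hσ.mem_image hX hx hxy.2 (hσ'.apply_ne_input hxy.1)
  obtain ⟨z, hz, hzy⟩ := this
  exact σ'.injective hzy ▸ hz

/-- The columns of the nodes in `avoiding a` vanish outside of the rows of these nodes and of `a`,
except for the row of the input node, so that they form a square block. -/
theorem IsMatching.image_avoiding (hσ : G.IsMatching σ) (ha : G.IsSuperSimple a) :
    σ '' G.avoiding a = insert a (G.avoiding a) \ {G.input} := by
  by_cases hai : a = G.input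
  · subst hai; simp [avoiding_input]
  refine Set.eq_of_subset_of_ncard_le ?_ ?_ (Set.toFinite _)
  · rintro _ ⟨x, hx, rfl⟩
    have hxo : x ≠ G.output := by rintro rfl; exact ha.output_notMem hx
    refine ⟨?_, hσ.apply_ne_input hxo⟩
    rcases hσ.2 x hxo with h | h
    · rw [← h]; exact .inr hx
    · by_cases hsa : σ x = a
      · exact .inl hsa
      · exact .inr (ReachIn.tail hx hsa h)
  · rw [Set.ncard_image_of_injective _ σ.injective,
      Set.ncard_sdiff_singleton_of_mem (.inr (input_mem_avoiding hai)),
      Set.ncard_insert_of_notMem self_notMem_avoiding (Set.toFinite _), Nat.add_sub_cancel]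

theorem IsMatching.avoiding_closed (hσ : G.IsMatching σ) (ha : G.IsSuperSimple a)
    (hl : l ∈ G.avoiding a) (h : G.MatchArrow σ l m) : m ∈ G.avoiding a := by
  have : σ m ∈ σ '' G.avoiding a := by
    rw [hσ.image_avoiding ha]
    refine ⟨?_, hσ.apply_ne_input h.1⟩
    rcases h.2 with h' | h'
    · rw [← h']; exact .inr hl
    · by_cases hsa : σ m = a
      · exact .inl hsa
      · exact .inr (ReachIn.tail hl hsa h')
  obtain ⟨z, hz, hzm⟩ := this
  exact σ.injective hzm ▸ hz

theorem IsMatching.mem_avoiding (hσ : G.IsMatching σ) (ha : G.IsSuperSimple a)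
    (hl : l ∈ G.avoiding a) (h : G.MatchReach σ l m) : m ∈ G.avoiding a :=
  h.mem_of_closed hl fun _ hx _ hxy => hσ.avoiding_closed ha hx hxy

/-- The arrows that leave a closed set of columns containing the input node all end in the same
node, which is therefore super-simple. -/
theorem IsMatching.exists_exit (hG : G.IsCore) (hσ : G.IsMatching σ)
    (hX : ∀ x ∈ X, ∀ y, G.MatchArrow σ x y → y ∈ X) (hi : G.input ∈ X) (ho : G.output ∉ X) :
    ∃ s, s ∉ X ∧ G.IsSuperSimple s ∧ G.avoiding s ⊆ X := by
  have hsub : X \ {G.input} ⊆ σ '' X := fun x hx => hσ.mem_image hX hx.1 (.inl rfl) hx.2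
  have hcard : (σ '' X \ (X \ {G.input})).ncard = 1 := by
    rw [Set.ncard_sdiff hsub, Set.ncard_image_of_injective _ σ.injective,
      Set.ncard_sdiff_singleton_of_mem hi]
    have : 0 < X.ncard := (Set.ncard_pos (Set.toFinite _)).2 ⟨_, hi⟩
    omega
  obtain ⟨s, hs⟩ := Set.ncard_eq_one.1 hcard
  have hs' : s ∈ σ '' X \ (X \ {G.input}) := by rw [hs]; rfl
  have hsX : s ∉ X := by
    intro h
    refine hs'.2 ⟨h, ?_⟩
    obtain ⟨x, hx, rfl⟩ := hs'.1
    exact hσ.apply_ne_input (by rintro rfl; exact ho hx)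
  have hav : G.avoiding s ⊆ X := by
    intro v hv
    refine ReachIn.mem_of_closed hv hi fun x hx y hy hxy => ?_
    by_contra hyX
    have : y ∈ σ '' X \ (X \ {G.input}) :=
      ⟨hσ.mem_image hX hx (.inr hxy) (by rintro rfl; exact hyX hi), fun h => hyX h.1⟩
    rw [hs] at this
    exact hy this
  exact ⟨s, hsX, hG.isSuperSimple_iff.2 fun h => ho (hav h), hav⟩

variable [DecidableEq V]

omit [Finite V] in
/-- A simple path from the input node to the output node gives the matching in which each node of
the path is matched with the next one, and every other node with itself. -/
theorem IsIOPath.isMatching {p : List V} (hp : G.IsIOPath p) : G.IsMatching p.formPerm := by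
  obtain ⟨h1, h2, h3, h4⟩ := hp
  obtain ⟨r, rfl⟩ : ∃ r, p = G.input :: r := by
    cases p with
    | nil => simp at h1
    | cons d r => simp at h1; exact ⟨r, by rw [h1]⟩
  have hlast : (G.input :: r).getLast (List.cons_ne_nil _ _) = G.output := by
    rw [List.getLast?_eq_some_getLast (List.cons_ne_nil _ _)] at h2
    exact Option.some.inj h2
  refine ⟨?_, fun l hl => ?_⟩
  · rw [← hlast, List.formPerm_apply_getLast]
  · by_cases hlp : l ∈ G.input :: r
    · obtain ⟨n, hn, rfl⟩ := List.getElem_of_mem hlp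
      have hn' : n + 1 < (G.input :: r).length := by
        by_contra! hlt
        refine hl ?_
        rw [← hlast, List.getLast_eq_getElem]
        congr 1
        omega
      rw [List.formPerm_apply_lt_getElem _ h4 n hn']
      exact .inr (List.isChain_iff_getElem.1 h3 n hn')
    · exact .inl (List.formPerm_apply_of_notMem hlp).symm

theorem IsMatching.matchReach_of_sublist (hσ : G.IsMatching σ) {p : List V} (hp : G.IsIOPath p)
    (h : [a, b].Sublist p) (hb : b ≠ G.output) : G.MatchReach σ b a := by
  refine hσ.matchReach hp.isMatching ?_ hb
  obtain ⟨r₁, r₂, hr, ha, hbr⟩ := List.cons_sublist_iff.1 h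
  rw [List.singleton_sublist] at hbr
  obtain ⟨i, hi, hia⟩ := List.getElem_of_mem ha
  obtain ⟨j, hj, hjb⟩ := List.getElem_of_mem hbr
  have hlen : (i + (j + (r₁.length - i))) < p.length := by rw [hr, List.length_append]; omega
  have key : ∀ k, ∀ hk : i + k < p.length, p[i + k] ≠ G.output →
      G.MatchReach p.formPerm p[i + k] p[i] := by
    intro k
    induction k with
    | zero => exact fun _ _ => MatchReach.refl
    | succ k ih =>
      intro hk hko
      have hk' : i + k + 1 < p.length := hk
      have hf := List.formPerm_apply_lt_getElem p hp.2.2.2 (i + k) hk'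
      have hne : p[i + k] ≠ G.output := by
        intro h
        have h1 := hp.isMatching.1
        rw [← h, hf] at h1
        have h0 : p[0] = G.input := by
          have := hp.1
          rw [List.head?_eq_getElem?, List.getElem?_eq_getElem (by omega)] at this
          exact Option.some.inj this
        rw [← h0] at h1
        have := (hp.2.2.2.getElem_inj_iff).1 h1
        omega
      exact Relation.ReflTransGen.head (⟨hne, .inl hf.symm⟩ : G.MatchArrow _ _ _) (ih (by omega) hne)
  have hb' : p[i + (j + (r₁.length - i))] = b := by
    subst hjb
    simp only [hr]
    rw [List.getElem_append_right (by omega)]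
    congr 1
    omega
  have ha' : p[i] = a := by
    subst hia
    simp only [hr]
    rw [List.getElem_append_left]
  have := key _ hlen (by rw [hb']; exact hb)
  rwa [hb', ha'] at this

omit [Finite V] in
theorem IsIOPath.matchReach_of_reachIn {p : List V} (hp : G.IsIOPath p)
    (h : G.ReachIn (complementary p) a b) : G.MatchReach p.formPerm a b := by
  obtain ⟨-, -, h⟩ := h
  refine Relation.ReflTransGen.mono (fun x y hxy => ⟨?_, .inr ?_⟩) _ _ h
  · rintro rfl; exact hxy.2.1 hp.right_mem
  · rw [List.formPerm_apply_of_notMem hxy.2.1]; exact hxy.2.2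

/-- The columns reachable from `a` are those of the nodes that can be reached from the input node
without passing the next super-simple node `b`. -/
theorem IsMatching.matchReach_iff (hG : G.IsCore) (hσ : G.IsMatching σ) (h : G.Consecutive a b) :
    G.MatchReach σ a v ↔ v ∈ G.avoiding b := by
  obtain ⟨ha, hb, hab, hbet⟩ := consecutive_iff.1 h
  have hao : a ≠ G.output := by rintro rfl; exact hb.output_notMem hab
  refine ⟨hσ.mem_avoiding hb hab, fun hv => ?_⟩
  obtain ⟨p, hp⟩ := hG.exists_isIOPath
  have hback : ∀ s, G.IsSuperSimple s → s ∈ G.avoiding a → G.MatchReach σ a s := fun s hs hsa =>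
    hσ.matchReach_of_sublist hp ((ha.sublist_iff_right hp (hs.2 p hp)).2 hsa) hao
  have hi : G.MatchReach σ a G.input := by
    by_cases hai : a = G.input
    · rw [hai]; exact MatchReach.refl
    · exact hback _ hG.isSuperSimple_input (input_mem_avoiding hai)
  obtain ⟨s, hsX, hs, hav⟩ := hσ.exists_exit hG (X := {v | G.MatchReach σ a v})
    (fun x hx y hxy => Relation.ReflTransGen.tail hx hxy) hi
    (fun h => h.ne_output hao rfl)
  by_cases hsb : s = b
  · exact hav (hsb ▸ hv)
  rcases hs.mem_or_mem hb hsb with h' | h'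
  · have has : a ≠ s := by rintro rfl; exact hsX MatchReach.refl
    exfalso
    rcases ha.mem_or_mem hs has with h'' | h''
    · exact hbet s hs h'' h'
    · exact hsX (hback s hs h'')
  · exact absurd (hσ.mem_avoiding hb hab (hav h')) self_notMem_avoiding

theorem IsMatching.matchReach_of_isSimple (hσ : G.IsMatching σ) (ha : G.IsSuperSimple a)
    (hv : G.IsSimple v) (hva : v ∉ G.avoiding a) (hvo : v ≠ G.output) : G.MatchReach σ v a := by
  by_cases h : v = a
  · rw [h]; exact MatchReach.refl
  obtain ⟨p, hp, hvp⟩ := hv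
  exact hσ.matchReach_of_sublist hp ((ha.sublist_iff_left hp hvp).2 ⟨h, hva⟩) hvo

end Matching

/-! ### Matchings through a given position -/

section Rotation

variable {V : Type*} [DecidableEq V] {G : IONetwork V} {σ : Equiv.Perm V} {a b x q v : V}

/-- Every nonzero position in a strong component of `MatchArrow` belongs to some matching: rotate
the given matching along a cycle through that position. -/
theorem IsMatching.exists_apply_eq (hσ : G.IsMatching σ) (hq : q ≠ G.output)
    (hxq : G.Couples x (σ q)) (hqx : G.MatchReach σ q x) :
    ∃ σ' : Equiv.Perm V, G.IsMatching σ' ∧ σ' x = σ q := by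
  obtain ⟨c, ⟨h1, h2, h3, h4⟩, hcN⟩ : ∃ c, ({ G with Adj := G.MatchArrow σ } :
      IONetwork V).IsSimplePath c q x ∧ ∀ y ∈ c, y ∈ ({G.output}ᶜ : Set V) := by
    refine ReachIn.exists_isSimplePath ?_
    clear hxq
    induction hqx with
    | refl => exact .refl hq
    | tail _ h ih => exact ih.tail h.1 h
  obtain ⟨r, rfl⟩ : ∃ r, c = q :: r := by
    cases c with
    | nil => simp at h1
    | cons d r => simp at h1; exact ⟨r, by rw [h1]⟩
  have hlast : (q :: r).getLast (List.cons_ne_nil _ _) = x := by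
    rw [List.getLast?_eq_some_getLast (List.cons_ne_nil _ _)] at h2
    exact Option.some.inj h2
  have hx : (q :: r).formPerm x = q := by rw [← hlast, List.formPerm_apply_getLast]
  refine ⟨σ * (q :: r).formPerm, ⟨?_, fun l hl => ?_⟩, by rw [Equiv.Perm.mul_apply, hx]⟩
  · rw [Equiv.Perm.mul_apply, List.formPerm_apply_of_notMem (fun h => hcN _ h rfl), hσ.1]
  · rw [Equiv.Perm.mul_apply]
    by_cases hlc : l ∈ q :: r
    · obtain ⟨n, hn, rfl⟩ := List.getElem_of_mem hlc
      by_cases hn' : n + 1 < (q :: r).length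
      · rw [List.formPerm_apply_lt_getElem _ h4 n hn']
        exact (List.isChain_iff_getElem.1 h3 n hn').2
      · have : (q :: r)[n] = x := by
          rw [← hlast, List.getLast_eq_getElem]
          congr 1
          omega
        rw [this, hx]
        exact hxq
    · rw [List.formPerm_apply_of_notMem hlc]
      exact hσ.2 l hl

variable [Fintype V]

/-- In a matching, the cycle through the input node is a simple path to the output node. -/
theorem IsMatching.isIOPath_toList (hσ : G.IsMatching σ) : G.IsIOPath (σ.toList G.input) := by
  have hsupp : G.input ∈ σ.support := by
    rw [Equiv.Perm.mem_support]
    exact hσ.apply_ne_input G.input_ne_output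
  have hlen := Equiv.Perm.length_toList_pos_of_mem_support σ G.input hsupp
  have h0 := Equiv.Perm.toList_getElem_zero σ G.input hsupp
  have hf := Equiv.Perm.formPerm_toList σ G.input
  have hnd := Equiv.Perm.nodup_toList σ G.input
  have hmem : ∀ y ∈ σ.toList G.input, (σ.toList G.input).formPerm y = σ y := fun y hy => by
    rw [hf, Equiv.Perm.cycleOf_apply, if_pos (Equiv.Perm.mem_toList_iff.1 hy).1]
  obtain ⟨r, hr⟩ : ∃ r, σ.toList G.input = G.input :: r := by
    cases h : σ.toList G.input with
    | nil => simp [h] at hlen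
    | cons d r => simp [h] at h0; exact ⟨r, by rw [h0]⟩
  have hlast : (G.input :: r).getLast (List.cons_ne_nil _ _) = G.output := by
    refine σ.injective ?_
    have hl := hmem ((G.input :: r).getLast (List.cons_ne_nil _ _))
      (by rw [hr]; exact List.getLast_mem _)
    rw [hσ.1, ← hl, hr, List.formPerm_apply_getLast]
  refine ⟨by rw [hr]; rfl, ?_, ?_, hnd⟩
  · rw [hr, List.getLast?_eq_some_getLast (List.cons_ne_nil _ _), hlast]
  · refine List.isChain_iff_getElem.2 fun n hn => ?_
    have h1 := List.formPerm_apply_lt_getElem _ hnd n hn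
    rw [hmem _ (List.getElem_mem _)] at h1
    rw [← h1]
    have hne : (σ.toList G.input)[n] ≠ G.output := by
      intro h
      rw [h, hσ.1] at h1
      have := hnd.getElem_inj_iff.1 (h0.trans h1)
      omega
    refine (hσ.2 _ hne).resolve_left fun h => ?_
    rw [← h, hnd.getElem_inj_iff] at h1
    omega

/-- A node outside of the cycle through the input node lies on a cycle of the complementary
subnetwork, together with the node with which it is matched. -/
theorem IsMatching.reachIn_of_apply_notMem (hσ : G.IsMatching σ)
    (hx : σ x ∉ σ.toList G.input) :
    G.ReachIn (complementary (σ.toList G.input)) x (σ x) ∧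
      G.ReachIn (complementary (σ.toList G.input)) (σ x) x := by
  have hsupp : G.input ∈ σ.support := by
    rw [Equiv.Perm.mem_support]
    exact hσ.apply_ne_input G.input_ne_output
  have hmem : ∀ y, y ∈ complementary (σ.toList G.input) ↔ ¬ σ.SameCycle G.input y := fun y => by
    simp [complementary, Equiv.Perm.mem_toList_iff, hsupp]
  have hstep : ∀ y, y ∈ complementary (σ.toList G.input) →
      G.ReachIn (complementary (σ.toList G.input)) y (σ y) := by
    intro y hy
    have hσy : σ y ∈ complementary (σ.toList G.input) := by
      rw [hmem] at hy ⊢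
      rwa [Equiv.Perm.sameCycle_apply_right]
    have hyo : y ≠ G.output := by
      rintro rfl
      exact hy hσ.isIOPath_toList.right_mem
    rcases hσ.2 y hyo with h | h
    · rw [← h]; exact .refl hy
    · exact .tail (.refl hy) hσy h
  have hx' : x ∈ complementary (σ.toList G.input) := by
    have : σ x ∈ complementary (σ.toList G.input) := hx
    rw [hmem] at this ⊢
    rwa [Equiv.Perm.sameCycle_apply_right] at this
  refine ⟨hstep x hx', ?_⟩
  have key : ∀ n : ℕ, G.ReachIn (complementary (σ.toList G.input)) (σ x) ((σ ^ n) (σ x)) := by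
    intro n
    induction n with
    | zero => exact .refl hx
    | succ n ih =>
      rw [pow_succ', Equiv.Perm.mul_apply]
      exact ih.trans (hstep _ ih.2.1)
  obtain ⟨n, hn⟩ := (Equiv.Perm.sameCycle_apply_left.2
    (Equiv.Perm.SameCycle.refl σ x)).exists_nat_pow_eq
  have := key n
  rwa [hn] at this

end Rotation

/-! ### The strong component of a super-simple node -/

section StructuralBlock

variable {V : Type*} [Fintype V] [DecidableEq V] {G : IONetwork V} {σ : Equiv.Perm V}
  {a b v x : V}

omit [Fintype V] [DecidableEq V] in
theorem ReachIn.of_component {N M : Set V} (h : G.ReachIn N a b) (h' : G.ReachIn N b a)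
    (hM : ∀ y, G.ReachIn N a y → G.ReachIn N y a → y ∈ M) : G.ReachIn M a b := by
  refine (ReachIn.mem_of_closed (X := {y | G.ReachIn N a y ∧
    (G.ReachIn N y a → G.ReachIn M a y)}) h ⟨.refl h.1, fun h => .refl (hM a h h)⟩ ?_).2 h'
  rintro y ⟨hy, hyM⟩ z hz hyz
  have haz := hy.tail hz hyz
  exact ⟨haz, fun hza => (hyM (.head hy.2.1 hyz hza)).tail (hM z haz hza) hyz⟩

/-- A super-appendage node never belongs to the strong component of a simple node. Otherwise some
arrow of this component enters the component of the node in the appendage subnetwork; by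
`IsMatching.exists_apply_eq`, this arrow belongs to a matching, where it lies on a cycle in the
complementary subnetwork of some simple path. -/
theorem IsSuperAppendage.not_matchReach (hv : G.IsSuperAppendage v) (hσ : G.IsMatching σ)
    (ha : G.IsSimple a) (hao : a ≠ G.output) (h : G.MatchReach σ a v) :
    ¬ G.MatchReach σ v a := by
  intro h'
  obtain ⟨p, hp, -⟩ := id ha
  replace h := hp.isMatching.matchReach hσ h hao
  replace h' := hp.isMatching.matchReach hσ h' (h.ne_output hao)
  set Q := G.transComponent {y | G.IsAppendage y} v
  have hQ : ∀ y ∈ Q, G.IsAppendage y := fun y hy => (mem_transComponent.1 hy).1.2.1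
  have hvQ : v ∈ Q := mem_transComponent.2 ⟨.refl hv.1, .refl hv.1⟩
  obtain ⟨x, q, hxQ, hqQ, hax, hxq, hqv⟩ : ∃ x q, x ∉ Q ∧ q ∈ Q ∧ G.MatchReach p.formPerm a x ∧
      G.MatchArrow p.formPerm x q ∧ G.MatchReach p.formPerm q v := by
    refine (MatchReach.mem_of_closed (X := {y | G.MatchReach p.formPerm a y ∧ (y ∈ Q →
      ∃ x q, x ∉ Q ∧ q ∈ Q ∧ G.MatchReach p.formPerm a x ∧
      G.MatchArrow p.formPerm x q ∧ G.MatchReach p.formPerm q y)}) h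
      ⟨MatchReach.refl, fun haQ => absurd ha (hQ a haQ)⟩ ?_).2 hvQ
    rintro y ⟨hy, hyQ⟩ z hyz
    refine ⟨Relation.ReflTransGen.tail hy hyz, fun hzQ => ?_⟩
    by_cases hyQ' : y ∈ Q
    · obtain ⟨x, q, h1, h2, h3, h4, h5⟩ := hyQ hyQ'
      exact ⟨x, q, h1, h2, h3, h4, Relation.ReflTransGen.tail h5 hyz⟩
    · exact ⟨y, z, hyQ', hzQ, hy, hyz, MatchReach.refl⟩
  have hqp : p.formPerm q = q :=
    List.formPerm_apply_of_notMem fun hqp => hQ q hqQ ⟨p, hp, hqp⟩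
  obtain ⟨σ', hσ', hσx⟩ := hp.isMatching.exists_apply_eq hxq.1 hxq.2
    ((hqv.trans h').trans hax)
  rw [hqp] at hσx
  have hS := hσ'.isIOPath_toList
  set S := σ'.toList G.input
  have hApp : {y | G.IsAppendage y} ⊆ complementary S := fun y hy hyS => hy ⟨S, hS, hyS⟩
  obtain ⟨h1, h2⟩ := hσ'.reachIn_of_apply_notMem (x := x) (by rw [hσx]; exact hApp (hQ q hqQ))
  rw [hσx] at h1 h2
  obtain ⟨h3, h4⟩ := mem_transComponent.1 hqQ
  have hvx := (h3.mono hApp).trans h2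
  have hxv := h1.trans (h4.mono hApp)
  have hcomp : ∀ y, G.ReachIn (complementary S) v y → G.ReachIn (complementary S) y v →
      G.IsAppendage y := fun y hy hy' =>
    hv.2 S hS (hApp hv.1) y (mem_transComponent.2 ⟨hy, hy'⟩)
  exact hxQ (mem_transComponent.2 ⟨hvx.of_component hxv hcomp, hxv.of_component hvx
    fun y hy hy' => hcomp y (hvx.trans hy) (hy'.trans hxv)⟩)

/-- The columns in the strong component of `a` are those of the nodes of the structural subnetwork
between `a` and the next super-simple node `b`, apart from `b`. -/
theorem Consecutive.mem_insert_augmentedSubnetwork_iff (hab : G.Consecutive a b) (hG : G.IsCore)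
    (hσ : G.IsMatching σ) : v ∈ insert a (G.augmentedSubnetwork a b) ↔
      G.MatchReach σ a v ∧ G.MatchReach σ v a := by
  have ha := hab.1
  have hb := hab.2.1
  have hao : a ≠ G.output := by
    rintro rfl
    exact hb.output_notMem (consecutive_iff.1 hab).2.2.1
  have hsimple : v ∈ G.avoiding b → G.IsSimple v → v ∉ G.avoiding a →
      G.MatchReach σ a v ∧ G.MatchReach σ v a := fun hvb hv hva =>
    ⟨(hσ.matchReach_iff hG hab).2 hvb, hσ.matchReach_of_isSimple ha hv hva
      (by rintro rfl; exact hb.output_notMem hvb)⟩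
  have hsimple' : ∀ x, G.IsSimple x → x ≠ a → G.MatchReach σ a x → G.MatchReach σ x a →
      x ∈ G.simpleSubnetwork a b := fun x hx hxa h1 h2 =>
    (mem_simpleSubnetwork ha hb).2 ⟨hx, hxa,
      fun h => self_notMem_avoiding (hσ.mem_avoiding ha h h2), (hσ.matchReach_iff hG hab).1 h1⟩
  constructor
  · rintro (rfl | hv | ⟨-, -, S, hS, -, ⟨x, hx, hxs⟩, -⟩)
    · exact ⟨MatchReach.refl, MatchReach.refl⟩
    · obtain ⟨h1, -, h2, h3⟩ := (mem_simpleSubnetwork ha hb).1 hv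
      exact hsimple h3 h1 h2
    · obtain ⟨h1, -, h2, h3⟩ := (mem_simpleSubnetwork ha hb).1 hxs
      have hxb := (hσ.matchReach_iff hG hab).2 h3
      have hxa := hσ.matchReach_of_isSimple ha h1 h2 (hxb.ne_output hao)
      obtain ⟨hvx, hxv⟩ := mem_transComponent.1 hx
      have hxv' := hσ.matchReach hS.isMatching (hS.matchReach_of_reachIn hxv) (hxb.ne_output hao)
      have hvx' := hσ.matchReach hS.isMatching (hS.matchReach_of_reachIn hvx)
        ((hxb.trans hxv').ne_output hao)
      exact ⟨hxb.trans hxv', hvx'.trans hxa⟩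
  · rintro ⟨h1, h2⟩
    by_cases hva : v = a
    · exact .inl hva
    refine .inr ?_
    by_cases hv : G.IsSimple v
    · exact .inl (hsimple' v hv hva h1 h2)
    have hvs : ¬ G.IsSuperAppendage v := fun h => h.not_matchReach hσ ha.1 hao h1 h2
    obtain ⟨S, hS, hvS, x, hx, hxs⟩ : ∃ S, G.IsIOPath S ∧ v ∈ complementary S ∧
        ∃ x ∈ G.transComponent (complementary S) v, G.IsSimple x := by
      by_contra! hcon
      exact hvs ⟨hv, hcon⟩
    have hmatch : ∀ y ∈ G.transComponent (complementary S) v,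
        G.MatchReach σ a y ∧ G.MatchReach σ y a := by
      intro y hy
      obtain ⟨hvy, hyv⟩ := mem_transComponent.1 hy
      have hvy' := hσ.matchReach hS.isMatching (hS.matchReach_of_reachIn hvy) (h1.ne_output hao)
      have hyv' := hσ.matchReach hS.isMatching (hS.matchReach_of_reachIn hyv)
        ((h1.trans hvy').ne_output hao)
      exact ⟨h1.trans hvy', hyv'.trans h2⟩
    have hne : ∀ y ∈ G.transComponent (complementary S) v, y ≠ a := by
      rintro y hy rfl
      exact (mem_transComponent.1 hy).1.2.1 (ha.2 S hS)
    refine .inr ⟨hv, hvs, S, hS, hvS, ⟨x, hx, hsimple' x hxs (hne x hx) (hmatch x hx).1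
      (hmatch x hx).2⟩, fun y hy => .inr ?_⟩
    by_cases hys : G.IsSimple y
    · exact .inl (hsimple' y hys (hne y hy) (hmatch y hy).1 (hmatch y hy).2)
    · exact .inr ⟨hys, fun h => h.not_matchReach hσ ha.1 hao (hmatch y hy).1 (hmatch y hy).2⟩

end StructuralBlock

/-! ### Structural subnetworks as homeostasis blocks -/

section HomeostasisBlock

variable {V : Type*} [Fintype V] [DecidableEq V] {G : IONetwork V} {σ : Equiv.Perm V}
  {a b v x : V} {R C : Set V}

omit [Fintype V] [DecidableEq V] in
theorem Consecutive.ne_output (h : G.Consecutive a b) : a ≠ G.output := by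
  rintro rfl
  exact h.2.1.output_notMem (consecutive_iff.1 h).2.2.1

omit [Fintype V] [DecidableEq V] in
theorem notMem_augmentedSubnetwork_left (ha : G.IsSuperSimple a) (hb : G.IsSuperSimple b) :
    a ∉ G.augmentedSubnetwork a b := by
  rintro (h | h)
  · exact ((mem_simpleSubnetwork ha hb).1 h).2.1 rfl
  · exact h.1 ha.1

theorem Consecutive.insert_augmentedSubnetwork_subset (hab : G.Consecutive a b) (hG : G.IsCore) :
    insert a (G.augmentedSubnetwork a b) ⊆ G.avoiding b := by
  intro v hv
  obtain ⟨p, hp⟩ := hG.exists_isIOPath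
  exact (hp.isMatching.matchReach_iff hG hab).1
    ((hab.mem_insert_augmentedSubnetwork_iff hG hp.isMatching).1 hv).1

theorem Consecutive.right_notMem (hab : G.Consecutive a b) (hG : G.IsCore) :
    b ∉ insert a (G.augmentedSubnetwork a b) := fun h =>
  self_notMem_avoiding (hab.insert_augmentedSubnetwork_subset hG h)

/-- In the matching of a simple path from the input to the output node, the columns of the strong
component of `a` are matched with the rows of `L'` and of the super-simple node after `a`. -/
theorem Consecutive.image_insert_augmentedSubnetwork (hab : G.Consecutive a b) (hG : G.IsCore)
    {p : List V} (hp : G.IsIOPath p) :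
    p.formPerm '' insert a (G.augmentedSubnetwork a b) =
      insert b (G.augmentedSubnetwork a b) := by
  have hσ := hp.isMatching
  have ha := hab.1
  have hb := hab.2.1
  have hao := hab.ne_output
  have hmem := fun v => hab.mem_insert_augmentedSubnetwork_iff (v := v) hG hσ
  have hav := hab.insert_augmentedSubnetwork_subset hG
  have hb' : b ∉ G.augmentedSubnetwork a b := fun h => hab.right_notMem hG (.inr h)
  have ha' := notMem_augmentedSubnetwork_left ha hb
  refine (Set.eq_of_subset_of_ncard_le ?_ ?_ (Set.toFinite _)).symm
  · intro l hl
    have hla : l ≠ a := by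
      rintro rfl
      rcases hl with rfl | hl
      · exact self_notMem_avoiding (consecutive_iff.1 hab).2.2.1
      · exact ha' hl
    have hlav : l ∉ G.avoiding a := by
      rintro hla
      rcases hl with rfl | hl
      · exact ha.notMem_of_mem hb (consecutive_iff.1 hab).2.2.1 hla
      · exact self_notMem_avoiding (hσ.mem_avoiding ha hla ((hmem l).1 (.inr hl)).2)
    have hli : l ≠ G.input := by
      rintro rfl
      by_cases hai : a = G.input
      · exact hla hai.symm
      · exact hlav (input_mem_avoiding hai)
    obtain ⟨m, rfl⟩ := p.formPerm.surjective l
    have hmb : m ∈ G.avoiding b := by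
      have : p.formPerm m ∈ p.formPerm '' G.avoiding b := by
        rw [hσ.image_avoiding hb]
        exact ⟨hl.imp id fun h => hav (.inr h), hli⟩
      obtain ⟨z, hz, hzm⟩ := this
      exact p.formPerm.injective hzm ▸ hz
    by_cases hmp : m ∈ p
    · refine ⟨m, (hmem m).2 ⟨(hσ.matchReach_iff hG hab).2 hmb,
        hσ.matchReach_of_isSimple ha ⟨p, hp, hmp⟩ (fun h => ?_) ?_⟩, rfl⟩
      · have : p.formPerm m ∈ p.formPerm '' G.avoiding a := ⟨m, h, rfl⟩
        rw [hσ.image_avoiding ha] at this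
        exact this.1.elim hla hlav
      · rintro rfl; exact hb.output_notMem hmb
    · rw [List.formPerm_apply_of_notMem hmp] at hl ⊢
      refine ⟨m, .inr (hl.resolve_left ?_), List.formPerm_apply_of_notMem hmp⟩
      rintro rfl
      exact hmp (hb.2 p hp)
  · rw [Set.ncard_image_of_injective _ p.formPerm.injective,
      Set.ncard_insert_of_notMem ha' (Set.toFinite _),
      Set.ncard_insert_of_notMem hb' (Set.toFinite _)]

/-- The strong component of `a` is irreducible as a block of the homeostasis matrix. -/
theorem Consecutive.isIrreducibleBlock (hab : G.Consecutive a b) (hG : G.IsCore)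
    (hσ : G.IsMatching σ) : G.IsIrreducibleBlock
      (σ '' insert a (G.augmentedSubnetwork a b)) (insert a (G.augmentedSubnetwork a b)) := by
  have hmem := fun v => hab.mem_insert_augmentedSubnetwork_iff (v := v) hG hσ
  set C := insert a (G.augmentedSubnetwork a b)
  refine ⟨⟨σ a, a, .inl rfl, rfl⟩, Set.ncard_image_of_injective _ σ.injective, ?_⟩
  intro R' hR' C' hC' hRn hCn hcard
  by_contra! hcon
  have hne : ∀ l ∈ C, l ≠ G.output := fun l hl => ((hmem l).1 hl).1.ne_output hab.ne_output
  -- The columns matched with the rows in `R'`.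
  set Z := σ ⁻¹' R' with hZ
  have hZR : σ '' Z = R' := Set.image_preimage_eq _ σ.surjective
  have hZC : Z ⊆ C := fun z hz => by
    obtain ⟨y, hy, hyz⟩ := hR' hz
    exact σ.injective hyz ▸ hy
  have hdisj : Disjoint C' Z := Set.disjoint_left.2 fun l hl hlZ =>
    hcon _ hlZ l hl (hσ.2 l (hne l (hC' hl)))
  have hunion : C' ∪ Z = C := by
    refine Set.eq_of_subset_of_ncard_le (Set.union_subset hC' hZC) ?_ (Set.toFinite _)
    rw [Set.ncard_union_eq hdisj (Set.toFinite _) (Set.toFinite _),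
      ← Set.ncard_image_of_injective Z σ.injective, hZR,
      ← Set.ncard_image_of_injective C σ.injective]
    omega
  obtain ⟨l, hl⟩ := hCn
  obtain ⟨_, hj⟩ := hRn
  rw [← hZR] at hj
  obtain ⟨z, hz, rfl⟩ := hj
  have hlz : G.MatchReach σ l z := ((hmem l).1 (hC' hl)).2.trans ((hmem z).1 (hZC hz)).1
  have : z ∈ C' := by
    refine (MatchReach.mem_of_closed (X := {y | G.MatchReach σ a y ∧
      (G.MatchReach σ y a → y ∈ C')}) hlz ⟨((hmem l).1 (hC' hl)).1, fun _ => hl⟩ ?_).2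
      ((hmem z).1 (hZC hz)).2
    rintro x ⟨hx1, hx2⟩ y hxy
    have hay : G.MatchReach σ a y := Relation.ReflTransGen.tail hx1 hxy
    refine ⟨hay, fun hya => ?_⟩
    have hxC := hx2 (Relation.ReflTransGen.head hxy hya)
    have hyC : y ∈ C' ∪ Z := hunion ▸ (hmem y).2 ⟨hay, hya⟩
    exact hyC.resolve_right fun hyZ => hcon _ hyZ x hxC hxy.2
  exact Set.disjoint_left.1 hdisj this hz

/-- The strong component of `a` is a diagonal block of a block triangular form with three levels:
the columns reachable from it, the component itself, and the remaining columns. -/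
theorem Consecutive.isHomeostasisBlock (hab : G.Consecutive a b) (hG : G.IsCore)
    (hσ : G.IsMatching σ) : G.IsHomeostasisBlock
      (σ '' insert a (G.augmentedSubnetwork a b)) (insert a (G.augmentedSubnetwork a b)) := by
  classical
  have hmem := fun v => hab.mem_insert_augmentedSubnetwork_iff (v := v) hG hσ
  have hirr := hab.isIrreducibleBlock hG hσ
  set C := insert a (G.augmentedSubnetwork a b)
  let c : V → ℕ := fun l =>
    if G.MatchReach σ a l then if G.MatchReach σ l a then 1 else 0 else 2
  have himage : ∀ m, {j | j ≠ G.input ∧ c (σ.symm j) = m} =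
      σ '' {l | l ≠ G.output ∧ c l = m} := by
    intro m
    ext j
    constructor
    · rintro ⟨h1, h2⟩
      refine ⟨σ.symm j, ⟨fun h => h1 ?_, h2⟩, by simp⟩
      rw [← hσ.1, ← h, Equiv.apply_symm_apply]
    · rintro ⟨l, ⟨h1, h2⟩, rfl⟩
      exact ⟨hσ.apply_ne_input h1, by simpa using h2⟩
  have hC : C = {l | l ≠ G.output ∧ c l = 1} := by
    ext l
    rw [hmem]
    simp only [c, Set.mem_ofPred_eq]
    constructor
    · rintro ⟨h1, h2⟩
      exact ⟨h1.ne_output hab.ne_output, by simp [h1, h2]⟩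
    · rintro ⟨-, h⟩
      split_ifs at h with h1 h2
      · exact ⟨h1, h2⟩
      · exact absurd h (by norm_num)
  have hmono : ∀ l m, G.MatchArrow σ l m → c m ≤ c l := by
    intro l m hlm
    simp only [c]
    by_cases h1 : G.MatchReach σ a l
    · have h2 : G.MatchReach σ a m := Relation.ReflTransGen.tail h1 hlm
      by_cases h3 : G.MatchReach σ m a
      · have h4 : G.MatchReach σ l a := Relation.ReflTransGen.head hlm h3
        simp [h1, h2, h3, h4]
      · simp [h2, h3]
    · simp only [h1, if_false]
      split_ifs <;> omega
  refine ⟨fun j => c (σ.symm j), c, 1, fun m => ?_, fun j l hj _ hlt hcpl => ?_, ?_, hC, hirr⟩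
  · rw [himage, Set.ncard_image_of_injective _ σ.injective]
  · refine hlt.not_ge (hmono _ _ ⟨fun h => hj ?_, by simpa using hcpl⟩)
    rw [← hσ.1, ← h, Equiv.apply_symm_apply]
  · rw [himage, ← hC]

omit [DecidableEq V] in
/-- A matching maps the columns of each diagonal block of a block triangular form to its rows. -/
theorem IsMatching.level_eq (hσ : G.IsMatching σ) {r c : V → ℕ}
    (hcard : ∀ m, {j | j ≠ G.input ∧ r j = m}.ncard = {l | l ≠ G.output ∧ c l = m}.ncard)
    (hzero : ∀ j l, j ≠ G.input → l ≠ G.output → c l < r j → ¬ G.Couples l j)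
    {l : V} (hl : l ≠ G.output) : r (σ l) = c l := by
  have hle : ∀ l, l ≠ G.output → r (σ l) ≤ c l := fun l hl => by
    by_contra! h
    exact hzero _ l (hσ.apply_ne_input hl) hl h (hσ.2 l hl)
  have hlt : ∀ m, {j | j ≠ G.input ∧ r j < m}.ncard = {l | l ≠ G.output ∧ c l < m}.ncard := by
    intro m
    induction m with
    | zero => simp
    | succ m ih =>
      have split : ∀ (u : V) (f : V → ℕ), {j | j ≠ u ∧ f j < m + 1}.ncard =
          {j | j ≠ u ∧ f j < m}.ncard + {j | j ≠ u ∧ f j = m}.ncard := by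
        intro u f
        rw [← Set.ncard_union_eq _ (Set.toFinite _) (Set.toFinite _)]
        · congr 1
          ext j
          simp only [Set.mem_ofPred_eq, Set.mem_union]
          rw [← and_or_left, Nat.lt_succ_iff_lt_or_eq]
        · exact Set.disjoint_left.2 fun j h1 h2 => h1.2.ne h2.2
      rw [split, split, ih, hcard]
  refine le_antisymm (hle l hl) (not_lt.1 fun h => ?_)
  have heq : σ '' {l' | l' ≠ G.output ∧ c l' < c l} = {j | j ≠ G.input ∧ r j < c l} := by
    refine Set.eq_of_subset_of_ncard_le ?_ ?_ (Set.toFinite _)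
    · rintro _ ⟨x, ⟨hx1, hx2⟩, rfl⟩
      exact ⟨hσ.apply_ne_input hx1, (hle x hx1).trans_lt hx2⟩
    · rw [hlt, Set.ncard_image_of_injective _ σ.injective]
  have : σ l ∈ σ '' {l' | l' ≠ G.output ∧ c l' < c l} := heq ▸ ⟨hσ.apply_ne_input hl, h⟩
  obtain ⟨z, hz, hzl⟩ := this
  obtain rfl := σ.injective hzl
  exact lt_irrefl _ hz.2

omit [Fintype V] [DecidableEq V] in
theorem structuralSubnetwork_eq : G.structuralSubnetwork a b =
    insert b (insert a (G.augmentedSubnetwork a b)) := by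
  ext v; simp only [structuralSubnetwork, Set.mem_union, Set.mem_insert_iff, Set.mem_singleton_iff]
  tauto

/-- The rows and columns of the homeostasis block of a structural subnetwork are unique. -/
theorem IsHomeostasisBlock.eq_of_union_eq (hRC : G.IsHomeostasisBlock R C) (hG : G.IsCore)
    (hab : G.Consecutive a b) (hU : G.structuralSubnetwork a b = R ∪ C) :
    R = insert b (G.augmentedSubnetwork a b) ∧ C = insert a (G.augmentedSubnetwork a b) := by
  obtain ⟨p, hp⟩ := hG.exists_isIOPath
  have hσ := hp.isMatching
  have hmem := fun v => hab.mem_insert_augmentedSubnetwork_iff (v := v) hG hσ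
  obtain ⟨r, c, k, hcard, hzero, hR, hC, ⟨⟨j, hj⟩, -⟩⟩ := hRC
  have hlev := fun l (hl : l ≠ G.output) => hσ.level_eq hcard hzero hl
  have hRimage : R = p.formPerm '' C := by
    rw [hR, hC]
    refine (Set.eq_of_subset_of_ncard_le ?_ ?_ (Set.toFinite _)).symm
    · rintro _ ⟨x, ⟨hx1, hx2⟩, rfl⟩
      exact ⟨hσ.apply_ne_input hx1, (hlev x hx1).trans hx2⟩
    · rw [hcard, Set.ncard_image_of_injective _ p.formPerm.injective]
  have hbC : b ∉ C := by
    intro hbC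
    have hbo : b ≠ G.output := by rw [hC] at hbC; exact hbC.1
    have h1 : p.formPerm b ∈ G.structuralSubnetwork a b :=
      hU ▸ .inl (hRimage ▸ ⟨b, hbC, rfl⟩)
    rw [structuralSubnetwork_eq] at h1
    have h2 : p.formPerm b ∈ p.formPerm '' G.avoiding b := by
      rw [hσ.image_avoiding hab.2.1]
      exact ⟨h1.imp id fun h => hab.insert_augmentedSubnetwork_subset hG h,
        hσ.apply_ne_input hbo⟩
    obtain ⟨z, hz, hzb⟩ := h2
    exact self_notMem_avoiding (p.formPerm.injective hzb ▸ hz)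
  have hCsub : C ⊆ insert a (G.augmentedSubnetwork a b) := by
    intro l hl
    have : l ∈ G.structuralSubnetwork a b := hU ▸ .inr hl
    rw [structuralSubnetwork_eq] at this
    refine this.resolve_left ?_
    rintro rfl
    exact hbC hl
  have hmono : ∀ l m, l ≠ G.output → G.MatchReach p.formPerm l m → m ≠ G.output ∧ c m ≤ c l := by
    intro l m hl hlm
    refine hlm.mem_of_closed (X := {m | m ≠ G.output ∧ c m ≤ c l}) ⟨hl, le_rfl⟩ ?_
    rintro x ⟨hx1, hx2⟩ y hxy
    refine ⟨hxy.1, le_trans ?_ hx2⟩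
    by_contra! hlt
    exact hzero _ x (hσ.apply_ne_input hxy.1) hx1 (by rwa [hlev y hxy.1]) hxy.2
  have hCeq : C = insert a (G.augmentedSubnetwork a b) := by
    refine hCsub.antisymm fun m hm => ?_
    rw [hRimage] at hj
    obtain ⟨l, hl, -⟩ := hj
    obtain ⟨h1, h2⟩ := (hmem l).1 (hCsub hl)
    obtain ⟨h3, h4⟩ := (hmem m).1 hm
    rw [hC] at hl ⊢
    obtain ⟨h5, h6⟩ := hmono l m hl.1 (h2.trans h3)
    exact ⟨h5, (h6.antisymm (hmono m l h5 (h4.trans h1)).2).trans hl.2⟩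
  exact ⟨by rw [hRimage, hCeq, hab.image_insert_augmentedSubnetwork hG hp], hCeq⟩

end HomeostasisBlock

/-! ### Linearization at an equilibrium -/

section Linearization

variable {V : Type*} [Fintype V] [DecidableEq V]

open Matrix

theorem fderiv_apply_eq (F : (V → ℝ) × ℝ → V → ℝ) (z : (V → ℝ) × ℝ) (v : V → ℝ) (s : ℝ) :
    fderiv ℝ F z (v, s) = stateJacobian F z *ᵥ v + s • fderiv ℝ F z (0, 1) := by
  have h : ((v, s) : (V → ℝ) × ℝ) =
      (∑ l, v l • ((Pi.single l 1, 0) : (V → ℝ) × ℝ)) + s • ((0 : V → ℝ), (1 : ℝ)) := by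
    refine Prod.ext ?_ ?_
    · simp only [Prod.fst_add, Prod.fst_sum, Prod.smul_fst, smul_zero, add_zero]
      ext k
      simp [Pi.single_apply]
    · simp [Prod.snd_sum]
  rw [h, map_add, map_sum, map_smul]
  congr 1
  ext j
  simp only [map_smul, Finset.sum_apply, Pi.smul_apply, smul_eq_mul, mulVec, dotProduct,
    stateJacobian, of_apply]
  exact Finset.sum_congr rfl fun l _ => mul_comm _ _

namespace AdmissibleSystem

variable {G : IONetwork V} (f : AdmissibleSystem G) {X₀ : V → ℝ} {I₀ : ℝ} {κ : V}

theorem differentiableAt (z : (V → ℝ) × ℝ) : DifferentiableAt ℝ f.toFun z :=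
  f.smooth.differentiable (by simp) z

theorem fderiv_param_apply (j : V) (hj : j ≠ G.input) :
    fderiv ℝ f.toFun (X₀, I₀) (0, 1) j = 0 := by
  have h1 : HasDerivAt (fun t : ℝ => ((X₀, t) : (V → ℝ) × ℝ)) ((0, 1) : (V → ℝ) × ℝ) I₀ :=
    (hasDerivAt_const I₀ X₀).prodMk (hasDerivAt_id I₀)
  have h2 := (f.differentiableAt (X₀, I₀)).hasFDerivAt.comp_hasDerivAt I₀ h1
  have h3 := (hasDerivAt_pi.1 h2) j
  refine h3.unique ?_
  have : (fun t : ℝ => (f.toFun ∘ fun t : ℝ => ((X₀, t) : (V → ℝ) × ℝ)) t j) =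
      fun _ => f.toFun (X₀, I₀) j := by
    ext t
    exact f.param_input_only j hj X₀ t I₀
  rw [this]
  exact hasDerivAt_const _ _

variable {f}

/-- The derivative of a family of equilibria solves the linearized equation. -/
theorem mulVec_deriv_add {X : ℝ → V → ℝ} (hX : X I₀ = X₀) (hd : DifferentiableAt ℝ X I₀)
    (he : ∀ᶠ I in nhds I₀, f.toFun (X I, I) = 0) :
    stateJacobian f.toFun (X₀, I₀) *ᵥ deriv X I₀ + fderiv ℝ f.toFun (X₀, I₀) (0, 1) = 0 := by
  have h1 : HasDerivAt (fun t : ℝ => ((X t, t) : (V → ℝ) × ℝ)) (deriv X I₀, 1) I₀ :=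
    hd.hasDerivAt.prodMk (hasDerivAt_id I₀)
  have h0 : HasFDerivAt f.toFun (fderiv ℝ f.toFun (X₀, I₀)) (X I₀, I₀) := by
    rw [hX]; exact (f.differentiableAt (X₀, I₀)).hasFDerivAt
  have h2 := HasFDerivAt.comp_hasDerivAt (f := fun t : ℝ => ((X t, t) : (V → ℝ) × ℝ)) I₀ h0 h1
  have h3 : HasDerivAt (f.toFun ∘ fun t : ℝ => ((X t, t) : (V → ℝ) × ℝ)) 0 I₀ :=
    (hasDerivAt_const I₀ (0 : V → ℝ)).congr_of_eventuallyEq he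
  have h4 := h2.unique h3
  rwa [fderiv_apply_eq, one_smul] at h4

omit [DecidableEq V] in
theorem deriv_apply {X : ℝ → V → ℝ} (hd : DifferentiableAt ℝ X I₀) :
    deriv (fun I => X I κ) I₀ = deriv X I₀ κ :=
  ((hasDerivAt_pi.1 hd.hasDerivAt) κ).deriv

theorem IsHyperbolicEquilibrium.det_ne_zero (h : f.IsHyperbolicEquilibrium X₀ I₀) :
    (stateJacobian f.toFun (X₀, I₀)).det ≠ 0 := by
  intro h0
  refine h.2 0 ?_ rfl
  rw [spectrum.zero_mem_iff, Matrix.isUnit_iff_isUnit_det]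
  have : ((stateJacobian f.toFun (X₀, I₀)).map (algebraMap ℝ ℂ)).det = 0 := by
    rw [← RingHom.mapMatrix_apply, ← RingHom.map_det, h0, map_zero]
  rw [this]
  exact not_isUnit_zero

/-- The numerator in Cramer's rule for the rate of change of the state variable of node `κ`. -/
noncomputable def rateNumerator (f : AdmissibleSystem G) (X₀ : V → ℝ) (I₀ : ℝ) (κ : V) : ℝ :=
  (stateJacobian f.toFun (X₀, I₀)).cramer (fderiv ℝ f.toFun (X₀, I₀) (0, 1)) κ

theorem rateNumerator_eq {x : V → ℝ}
    (hx : stateJacobian f.toFun (X₀, I₀) *ᵥ x + fderiv ℝ f.toFun (X₀, I₀) (0, 1) = 0) :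
    f.rateNumerator X₀ I₀ κ = -((stateJacobian f.toFun (X₀, I₀)).det * x κ) := by
  rw [rateNumerator, ← neg_eq_of_add_eq_zero_right hx, map_neg, cramer_eq_adjugate_mulVec,
    mulVec_mulVec, adjugate_mul, smul_mulVec, one_mulVec]
  simp

theorem IsHomeostatic.rateNumerator_eq_zero (h : f.IsHomeostatic X₀ I₀ κ) :
    f.rateNumerator X₀ I₀ κ = 0 := by
  obtain ⟨X, h1, h2, h3, h4⟩ := h
  rw [rateNumerator_eq (mulVec_deriv_add h1 h2 h3), ← deriv_apply h2, h4]
  simp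

theorem continuous_fderiv_apply (z w : (V → ℝ) × ℝ) :
    Continuous fun f : AdmissibleSystem G => fderiv ℝ f.toFun z w := by
  have h1 : Continuous (AdmissibleSystem.jet (G := G) 1) :=
    continuous_iff_le_induced.2 (iInf_le _ 1)
  have h2 : Continuous fun f : AdmissibleSystem G => (f.jet 1 z) fun _ => w :=
    (continuous_eval_const (F := ContinuousMultilinearMap ℝ
      (fun _ : Fin 1 => (V → ℝ) × ℝ) (V → ℝ)) (fun _ => w)).comp
      ((continuous_eval_const z).comp h1)
  refine h2.congr fun f => ?_
  exact iteratedFDeriv_one_apply (𝕜 := ℝ) (f := f.toFun) (x := z) (fun _ => w)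

theorem continuous_rateNumerator (X₀ : V → ℝ) (I₀ : ℝ) (κ : V) :
    Continuous fun f : AdmissibleSystem G => f.rateNumerator X₀ I₀ κ := by
  have hJ : Continuous fun f : AdmissibleSystem G => stateJacobian f.toFun (X₀, I₀) :=
    continuous_matrix fun j l =>
      (continuous_apply j).comp (continuous_fderiv_apply (X₀, I₀) (Pi.single l 1, 0))
  simp only [rateNumerator, cramer_apply]
  exact (hJ.matrix_updateCol κ (continuous_fderiv_apply (X₀, I₀) (0, 1))).matrix_det

theorem stateJacobian_eq_zero {j l : V} (h : ¬ G.Couples l j) (z : (V → ℝ) × ℝ) :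
    stateJacobian f.toFun z j l = 0 := (f.jacobian_zero_iff j l).2 h z

/-- If the determinant of the block with columns `C` vanishes, then so does the one of the block
with columns `N`, provided that the columns in `N \ C` vanish in the rows matched with `C`. -/
theorem BlockDetVanishes.exists_mulVec_eq_zero {C N : Set V} (σ : Equiv.Perm V) (hCN : C ⊆ N)
    (h : f.BlockDetVanishes X₀ I₀ (σ '' C) C)
    (hz : ∀ m ∈ C, ∀ l ∈ N, l ∉ C → ¬ G.Couples l (σ m)) :
    ∃ w : V → ℝ, w ≠ 0 ∧ (∀ l ∉ N, w l = 0) ∧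
      ∀ m ∈ N, (stateJacobian f.toFun (X₀, I₀) *ᵥ w) (σ m) = 0 := by
  classical
  set J := stateJacobian f.toFun (X₀, I₀)
  obtain ⟨e, he⟩ := h
  have hdet : (of fun i l : C => J (σ i) l).det = 0 := by
    have hperm : (of fun i l : C => J (σ i) l) =
        (of fun i l : C => J (e i) l).submatrix ((σ.image C).trans e.symm) id := by
      ext i l
      simp [Equiv.image]
    rw [hperm, det_permute]
    convert mul_zero _
  obtain ⟨u, hu, hu0⟩ := exists_vecMul_eq_zero_iff.2 hdet
  -- A square matrix on all nodes: the block with columns `N`, completed by an identity block.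
  let P : Matrix V V ℝ := of fun m l =>
    if m ∈ N then (if l ∈ N then J (σ m) l else 0) else if m = l then 1 else 0
  let u' : V → ℝ := fun m => if h : m ∈ C then u ⟨m, h⟩ else 0
  have hu' : u' ≠ 0 := by
    obtain ⟨i, hi⟩ := Function.ne_iff.1 hu
    exact Function.ne_iff.2 ⟨i, by simpa [u'] using hi⟩
  have hu'P : u' ᵥ* P = 0 := by
    ext l
    have hsum : (u' ᵥ* P) l = ∑ i : C, u i * P i l :=
      (Fintype.sum_of_injective Subtype.val Subtype.val_injective (fun i : C => u i * P i l)
        (fun m => u' m * P m l) (fun m hm => by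
          have : m ∉ C := fun h => hm ⟨⟨m, h⟩, rfl⟩
          simp [u', this]) (fun i => by simp [u'])).symm
    rw [hsum, Pi.zero_apply]
    by_cases hlC : l ∈ C
    · have := congrFun hu0 ⟨l, hlC⟩
      rw [Pi.zero_apply] at this
      rw [← this]
      exact Finset.sum_congr rfl fun i _ => by simp [P, hCN i.2, hCN hlC]
    · refine Finset.sum_eq_zero fun i _ => ?_
      by_cases hlN : l ∈ N
      · have : J (σ i) l = 0 := stateJacobian_eq_zero (hz i i.2 l hlN hlC) _
        simp [P, hCN i.2, hlN, this]
      · simp [P, hCN i.2, hlN]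
  have hdetP : P.det = 0 := exists_vecMul_eq_zero_iff.1 ⟨u', hu', hu'P⟩
  obtain ⟨w, hw, hPw⟩ := exists_mulVec_eq_zero_iff.2 hdetP
  have hwN : ∀ l ∉ N, w l = 0 := by
    intro l hl
    have := congrFun hPw l
    simpa [P, mulVec, dotProduct, hl] using this
  refine ⟨w, hw, hwN, fun m hm => ?_⟩
  have := congrFun hPw m
  simp only [P, mulVec, dotProduct, of_apply, hm, if_true, Pi.zero_apply] at this
  rw [← this]
  refine Finset.sum_congr rfl fun l _ => ?_
  by_cases hl : l ∈ N
  · simp [hl]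
  · simp [hl, hwN l hl]

end AdmissibleSystem

end Linearization

/-! ### Induced nodes -/

section Induced

variable {V : Type*} [Fintype V] [DecidableEq V] {G : IONetwork V} {a b κ : V}

open Matrix

/-- If the determinant of the structural block between `a` and `b` vanishes, then so does the one
of the square block with columns `avoiding b`. Its kernel vector shows that the rate of change of
all nodes outside of `avoiding b` is zero. -/
theorem Consecutive.isHomeostatic (hab : G.Consecutive a b) (hG : G.IsCore) {σ : Equiv.Perm V}
    (hσ : G.IsMatching σ) (hκ : κ ∉ G.avoiding b) {X₀ : V → ℝ} {I₀ : ℝ} {f : AdmissibleSystem G}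
    (hf : f ∈ inducingSystems G X₀ I₀ (σ '' insert a (G.augmentedSubnetwork a b))
      (insert a (G.augmentedSubnetwork a b))) : f.IsHomeostatic X₀ I₀ κ := by
  obtain ⟨hhyp, ⟨X, hX0, hXd, hXe, -⟩, hdet⟩ := hf
  refine ⟨X, hX0, hXd, hXe, ?_⟩
  rw [AdmissibleSystem.deriv_apply hXd]
  have hx := AdmissibleSystem.mulVec_deriv_add hX0 hXd hXe
  have hmem := fun v => hab.mem_insert_augmentedSubnetwork_iff (v := v) hG hσ
  have hb := hab.2.1
  obtain ⟨w, hw, hwN, hwJ⟩ := hdet.exists_mulVec_eq_zero (N := G.avoiding b) σ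
    (hab.insert_augmentedSubnetwork_subset hG) (by
      intro m hm l hl hlC hcpl
      have hm' := (hmem m).1 hm
      exact hlC ((hmem l).2 ⟨(hσ.matchReach_iff hG hab).2 hl,
        Relation.ReflTransGen.head ⟨hm'.1.ne_output hab.ne_output, hcpl⟩ hm'.2⟩))
  set J := stateJacobian f.toFun (X₀, I₀)
  set F := fderiv ℝ f.toFun (X₀, I₀) (0, 1)
  have hwJ' : ∀ j, j ≠ G.input → (J *ᵥ w) j = 0 := by
    intro j hj
    obtain ⟨m, rfl⟩ := σ.surjective j
    by_cases hm : m ∈ G.avoiding b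
    · exact hwJ m hm
    have hmo : m ≠ G.output := by rintro rfl; exact hj hσ.1
    refine Finset.sum_eq_zero fun l _ => ?_
    by_cases hl : l ∈ G.avoiding b
    · have h0 : J (σ m) l = 0 := AdmissibleSystem.stateJacobian_eq_zero
        (fun h => hm (hσ.avoiding_closed hb hl ⟨hmo, h⟩)) _
      show J (σ m) l * w l = 0
      rw [h0, zero_mul]
    · rw [hwN l hl, mul_zero]
  have hinj : ∀ v, J *ᵥ v = 0 → v = 0 := fun v hv => by
    by_contra hne
    exact hhyp.det_ne_zero (exists_mulVec_eq_zero_iff.1 ⟨v, hne, hv⟩)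
  have hne : (J *ᵥ w) G.input ≠ 0 := by
    intro h0
    refine hw (hinj w (funext fun j => ?_))
    by_cases hj : j = G.input
    · rw [hj, h0]; rfl
    · exact hwJ' j hj
  -- Both `J w` and `J X'` are multiples of the unit vector of the input node.
  have hcomb : (J *ᵥ w) G.input • deriv X I₀ + F G.input • w = 0 := by
    refine hinj _ ?_
    rw [mulVec_add, mulVec_smul, mulVec_smul, eq_neg_of_add_eq_zero_left hx]
    ext j
    simp only [Pi.add_apply, Pi.smul_apply, Pi.neg_apply, smul_eq_mul, Pi.zero_apply]
    by_cases hj : j = G.input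
    · rw [hj]; ring
    · rw [hwJ' j hj, show F j = 0 from f.fderiv_param_apply j hj]; ring
  have := congrFun hcomb κ
  simpa [hwN κ hκ, hne] using this

theorem Consecutive.induces (hab : G.Consecutive a b) (hG : G.IsCore) (hκ : κ ∉ G.avoiding b)
    (X₀ : V → ℝ) (I₀ : ℝ) : G.Induces X₀ I₀ (G.structuralSubnetwork a b) κ := by
  obtain ⟨p, hp⟩ := hG.exists_isIOPath
  have hσ := hp.isMatching
  refine ⟨_, _, hab.isHomeostasisBlock hG hσ, ?_, Set.univ, isOpen_univ, dense_univ,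
    fun f _ => hab.isHomeostatic hG hσ hκ f.2⟩
  rw [hab.image_insert_augmentedSubnetwork hG hp, structuralSubnetwork_eq]
  ext v
  simp only [Set.mem_union, Set.mem_insert_iff]
  tauto

end Induced

/-! ### A spanning tree -/

section SpanningTree

variable {V : Type*} (G : IONetwork V) {a b v : V}

/-- The nodes that can be reached from the input node by a walk of `n` arrows none of which ends
in `b`. -/
def layer (b : V) : ℕ → Set V
  | 0 => {G.input}
  | n + 1 => {v | v ≠ b ∧ ∃ u ∈ layer b n, G.Adj u v}

variable {G}

/-- The nodes of `avoiding b` are spanned by a tree rooted at the input node, given by the parent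
`par v` and the depth `d v` of each node `v`. -/
theorem exists_spanningTree (hb : b ≠ G.input) : ∃ (par : V → V) (d : V → ℕ),
    ∀ v ∈ G.avoiding b, v ≠ G.input →
      par v ∈ G.avoiding b ∧ G.Adj (par v) v ∧ d (par v) < d v := by
  classical
  have hsub : ∀ n, G.layer b n ⊆ G.avoiding b := by
    intro n
    induction n with
    | zero => rintro v rfl; exact input_mem_avoiding hb
    | succ n ih =>
      rintro v ⟨hvb, u, hu, huv⟩
      exact ReachIn.tail (ih hu) hvb huv
  have hex : ∀ v ∈ G.avoiding b, ∃ n, v ∈ G.layer b n := by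
    intro v hv
    refine ReachIn.mem_of_closed (X := {v | ∃ n, v ∈ G.layer b n}) hv ⟨0, rfl⟩ ?_
    rintro x ⟨n, hn⟩ y hy hxy
    exact ⟨n + 1, hy, x, hn, hxy⟩
  let d : V → ℕ := fun v => sInf {n | v ∈ G.layer b n}
  have key : ∀ v, ∃ u, v ∈ G.avoiding b → v ≠ G.input →
      u ∈ G.avoiding b ∧ G.Adj u v ∧ d u < d v := by
    intro v
    by_cases h : v ∈ G.avoiding b ∧ v ≠ G.input
    · have hm : v ∈ G.layer b (d v) := Nat.sInf_mem (hex v h.1)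
      cases hd : d v with
      | zero => rw [hd] at hm; exact absurd hm h.2
      | succ n =>
        rw [hd] at hm
        obtain ⟨-, u, hu, huv⟩ := hm
        exact ⟨u, fun _ _ => ⟨hsub n hu, huv, Nat.lt_succ_of_le (Nat.sInf_le hu)⟩⟩
    · exact ⟨v, fun h1 h2 => absurd ⟨h1, h2⟩ h⟩
  choose par hpar using key
  exact ⟨par, d, hpar⟩

end SpanningTree

/-! ### The tree system -/

section TreeSystem

variable {V : Type*} [Fintype V] [DecidableEq V] (G : IONetwork V)

open Classical in
/-- An auxiliary admissible system, in terms of a set `N` of nodes spanned by a tree with root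
`input` in which `par j` is the parent of `j`. For `t = I - I₀` and `y = x - X₀` it reads
`y_j' = -y_j + y_{par j} + ∑ y_l y_j (y_l - y_j)`, with the parameter `t` in place of `y_{par j}`
for the input node, and without this term for the nodes outside of `N`; the sum runs over the
arrows `l → j`. It has the equilibria in which `y_j` is `t` for the nodes of `N` and zero for the
other nodes. -/
noncomputable def treeField (N : Set V) (par : V → V) (X₀ : V → ℝ) (I₀ : ℝ) :
    (V → ℝ) × ℝ → (V → ℝ) := fun z j =>
  -(z.1 j - X₀ j) + (if j ∈ N ∧ j ≠ G.input then z.1 (par j) - X₀ (par j) else 0) +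
    (∑ l, if l ≠ j ∧ G.Adj l j then
      (z.1 l - X₀ l) * (z.1 j - X₀ j) * ((z.1 l - X₀ l) - (z.1 j - X₀ j)) else 0) +
    if j = G.input then z.2 - I₀ else 0

variable {G} {N : Set V} {par : V → V} {X₀ : V → ℝ} {I₀ : ℝ}

open Classical in
theorem contDiff_treeField : ContDiff ℝ ∞ (G.treeField N par X₀ I₀) := by
  rw [contDiff_pi]
  intro j
  have hx : ∀ k, ContDiff ℝ ∞ fun z : (V → ℝ) × ℝ => z.1 k - X₀ k := fun k => by fun_prop
  unfold treeField
  refine (((hx j).neg.add ?_).add (ContDiff.sum fun l _ => ?_)).add ?_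
  · split_ifs
    · exact hx _
    · exact contDiff_const
  · split_ifs
    · exact ((hx l).mul (hx j)).mul ((hx l).sub (hx j))
    · exact contDiff_const
  · split_ifs
    · fun_prop
    · exact contDiff_const

open Classical in
theorem stateJacobian_treeField (z : (V → ℝ) × ℝ) (j l : V) :
    stateJacobian (G.treeField N par X₀ I₀) z j l =
      -(if j = l then 1 else 0) + (if (j ∈ N ∧ j ≠ G.input) ∧ par j = l then 1 else 0) +
      ∑ k, if k ≠ j ∧ G.Adj k j then
        ((if k = l then 1 else 0) * (z.1 j - X₀ j) + (z.1 k - X₀ k) * (if j = l then 1 else 0)) *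
          ((z.1 k - X₀ k) - (z.1 j - X₀ j)) + (z.1 k - X₀ k) * (z.1 j - X₀ j) *
          ((if k = l then 1 else 0) - (if j = l then 1 else 0)) else 0 := by
  have hline : HasDerivAt (fun t : ℝ => z + t • ((Pi.single l 1, 0) : (V → ℝ) × ℝ))
      (Pi.single l 1, 0) 0 := by
    simpa using ((hasDerivAt_id (0 : ℝ)).smul_const
      ((Pi.single l 1, 0) : (V → ℝ) × ℝ)).const_add z
  have hF : HasFDerivAt (G.treeField N par X₀ I₀) (fderiv ℝ (G.treeField N par X₀ I₀) z)
      (z + (0 : ℝ) • ((Pi.single l 1, 0) : (V → ℝ) × ℝ)) := by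
    rw [zero_smul, add_zero]
    exact (contDiff_treeField.differentiable (by simp) z).hasFDerivAt
  have h1 := (hasDerivAt_pi.1 (HasFDerivAt.comp_hasDerivAt
    (f := fun t : ℝ => z + t • ((Pi.single l 1, 0) : (V → ℝ) × ℝ)) 0 hF hline)) j
  have hy : ∀ k, HasDerivAt (fun t : ℝ =>
      (z + t • ((Pi.single l 1, 0) : (V → ℝ) × ℝ)).1 k - X₀ k) (if k = l then 1 else 0) 0 := by
    intro k
    have h2 := ((hasDerivAt_id (0 : ℝ)).mul_const (if k = l then (1 : ℝ) else 0)).const_add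
      (z.1 k - X₀ k)
    rw [one_mul] at h2
    refine h2.congr_of_eventuallyEq (Filter.Eventually.of_forall fun t => ?_)
    simp only [Prod.fst_add, Prod.smul_fst, Pi.add_apply, Pi.smul_apply, Pi.single_apply,
      smul_eq_mul, id]
    ring
  have hy0 : ∀ k, (z + (0 : ℝ) • ((Pi.single l 1, 0) : (V → ℝ) × ℝ)).1 k - X₀ k =
      z.1 k - X₀ k := fun k => by simp
  refine h1.unique ?_
  show HasDerivAt (fun t : ℝ => G.treeField N par X₀ I₀
    (z + t • ((Pi.single l 1, 0) : (V → ℝ) × ℝ)) j) _ 0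
  unfold treeField
  rw [← add_zero (_ + _ + ∑ k, _)]
  refine (((hy j).neg.add ?_).add (HasDerivAt.fun_sum fun k _ => ?_)).add ?_
  · by_cases h : j ∈ N ∧ j ≠ G.input
    · simpa [h] using hy (par j)
    · simpa [h] using hasDerivAt_const (0 : ℝ) (0 : ℝ)
  · by_cases h : k ≠ j ∧ G.Adj k j
    · simp only [h, ne_eq, not_false_eq_true, and_self, if_true]
      have := ((hy k).mul (hy j)).mul ((hy k).sub (hy j))
      simp only [hy0, Pi.mul_apply, Pi.sub_apply] at this
      exact this
    · simpa only [if_neg h] using hasDerivAt_const (0 : ℝ) (0 : ℝ)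
  · simpa using hasDerivAt_const (0 : ℝ) (if j = G.input then z.2 - I₀ else 0)

open Classical in
theorem stateJacobian_treeField_base (t : ℝ) (j l : V) :
    stateJacobian (G.treeField N par X₀ I₀) (X₀, t) j l =
      -(if j = l then 1 else 0) + (if (j ∈ N ∧ j ≠ G.input) ∧ par j = l then 1 else 0) := by
  simp [stateJacobian_treeField]

end TreeSystem

section TreeSystem

variable {V : Type*} [Fintype V] [DecidableEq V] {G : IONetwork V}
  {N : Set V} {par : V → V} {d : V → ℕ} {X₀ : V → ℝ} {I₀ : ℝ} {a b κ : V}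

open Matrix

theorem exists_treeSystem (htree : ∀ v ∈ N, v ≠ G.input →
      par v ∈ N ∧ G.Adj (par v) v ∧ d (par v) < d v) (X₀ : V → ℝ) (I₀ : ℝ) :
    ∃ f : AdmissibleSystem G, f.toFun = G.treeField N par X₀ I₀ := by
  classical
  refine ⟨⟨G.treeField N par X₀ I₀, contDiff_treeField, fun j hj x I I' => ?_, fun j l => ?_⟩, rfl⟩
  · simp [treeField, hj]
  constructor
  · intro h hc
    by_cases hjl : j = l
    · subst hjl
      have h0 := h (X₀, 0)
      rw [stateJacobian_treeField_base] at h0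
      have : ¬ ((j ∈ N ∧ j ≠ G.input) ∧ par j = j) := fun h => by
        have := (htree j h.1.1 h.1.2).2.2
        rw [h.2] at this
        exact lt_irrefl _ this
      simp [this] at h0
    · have hadj := hc.resolve_left (Ne.symm hjl)
      -- Where all `y_k` are one, the cubic term `y_l y_j (y_l - y_j)` has derivative one.
      have h1 := h (X₀ + 1, 0)
      rw [stateJacobian_treeField, Finset.sum_eq_single l (fun k _ hk => by simp [hk, hjl])
        (by simp), if_pos (show l ≠ j ∧ G.Adj l j from ⟨Ne.symm hjl, hadj⟩)] at h1
      simp only [if_neg hjl, if_true, Pi.add_apply, Pi.one_apply, add_sub_cancel_left] at h1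
      split_ifs at h1 <;> norm_num at h1
  · intro h z
    have hjl : j ≠ l := fun h' => h (.inl h'.symm)
    have hpar : ¬ ((j ∈ N ∧ j ≠ G.input) ∧ par j = l) := fun h' =>
      h (.inr (h'.2 ▸ (htree j h'.1.1 h'.1.2).2.1))
    rw [stateJacobian_treeField, Finset.sum_eq_zero]
    · simp [hjl, hpar]
    · intro k _
      split_ifs with h1 h2
      · exact absurd (.inr (h2 ▸ h1.2)) h
      · simp
      · rfl

open Classical in
theorem treeField_family (hι : G.input ∈ N) (htree : ∀ v ∈ N, v ≠ G.input →
      par v ∈ N ∧ G.Adj (par v) v ∧ d (par v) < d v) (t : ℝ) :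
    G.treeField N par X₀ I₀ (fun j => X₀ j + (t - I₀) * if j ∈ N then 1 else 0, t) = 0 := by
  ext j
  simp only [treeField, add_sub_cancel_left, Pi.zero_apply]
  rw [Finset.sum_eq_zero]
  · by_cases hj : j ∈ N
    · by_cases hji : j = G.input
      · subst hji; simp [hι]
      · simp [hj, hji, (htree j hj hji).1]
    · have hji : j ≠ G.input := by rintro rfl; exact hj hι
      simp [hj, hji]
  · intro l _
    split_ifs <;> ring

theorem treeField_mulVec (t : ℝ) (v : V → ℝ) (j : V) :
    (stateJacobian (G.treeField N par X₀ I₀) (X₀, t) *ᵥ v) j =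
      -v j + Set.indicator {j | j ∈ N ∧ j ≠ G.input} (fun j => v (par j)) j := by
  classical
  simp only [mulVec, dotProduct, stateJacobian_treeField_base, add_mul, Finset.sum_add_distrib,
    neg_mul, ite_mul, one_mul, zero_mul, Finset.sum_neg_distrib, Finset.sum_ite_eq,
    Finset.mem_univ, if_true, Set.indicator_apply, Set.mem_ofPred_eq]
  congr 1
  by_cases h : j ∈ N ∧ j ≠ G.input
  · simp [h]
  · simp [h]

theorem isHyperbolicEquilibrium_of_treeField {f : AdmissibleSystem G}
    (hf : f.toFun = G.treeField N par X₀ I₀) (hι : G.input ∈ N)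
    (htree : ∀ v ∈ N, v ≠ G.input → par v ∈ N ∧ G.Adj (par v) v ∧ d (par v) < d v) :
    f.IsHyperbolicEquilibrium X₀ I₀ := by
  classical
  constructor
  · have := treeField_family (X₀ := X₀) (I₀ := I₀) hι htree I₀
    simpa [hf] using this
  · intro μ hμ hre
    have hμ1 : μ + 1 ≠ 0 := by
      intro h
      have := congrArg Complex.re h
      simp [hre] at this
    rw [spectrum.mem_iff, Matrix.isUnit_iff_isUnit_det, isUnit_iff_ne_zero, not_not] at hμ
    obtain ⟨v, hv, hv0⟩ := exists_mulVec_eq_zero_iff.2 hμ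
    -- The eigenvector equations can be solved along the tree.
    have heq : ∀ j, (μ + 1) * v j = if j ∈ N ∧ j ≠ G.input then v (par j) else 0 := by
      intro j
      have h := congrFun hv0 j
      rw [sub_mulVec, Pi.sub_apply, Pi.zero_apply, Algebra.algebraMap_eq_smul_one, smul_mulVec,
        one_mulVec, Pi.smul_apply, smul_eq_mul] at h
      have h' : ((stateJacobian f.toFun (X₀, I₀)).map (algebraMap ℝ ℂ) *ᵥ v) j =
          -v j + if j ∈ N ∧ j ≠ G.input then v (par j) else 0 := by
        simp only [mulVec, dotProduct, map_apply, hf, stateJacobian_treeField_base]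
        have : ∀ l, (algebraMap ℝ ℂ) (-(if j = l then 1 else 0) +
            if (j ∈ N ∧ j ≠ G.input) ∧ par j = l then 1 else 0) * v l =
            -(if j = l then v l else 0) +
            if (j ∈ N ∧ j ≠ G.input) ∧ par j = l then v l else 0 := by
          intro l
          split_ifs <;> simp
        simp only [this, Finset.sum_add_distrib, Finset.sum_neg_distrib, Finset.sum_ite_eq,
          Finset.mem_univ, if_true]
        congr 1
        by_cases h : j ∈ N ∧ j ≠ G.input
        · simp [h]
        · simp [h]
      rw [h'] at h
      linear_combination h
    refine hv (funext fun j => ?_)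
    induction hn : d j using Nat.strong_induction_on generalizing j with
    | _ n ih =>
      have h := heq j
      split_ifs at h with hj
      · rw [ih _ (hn ▸ (htree j hj.1 hj.2).2.2) (par j) rfl] at h
        exact (mul_eq_zero.1 h).resolve_left hμ1
      · exact (mul_eq_zero.1 h).resolve_left hμ1

/-- The block with rows `R` and columns `C` is singular for the tree system if it contains the
column but not the row of `a`, and only rows outside of the tree besides those of nodes of `C`. A
kernel vector is the indicator function of the part of `C` that hangs below `a`. -/
theorem blockDetVanishes_of_treeField {f : AdmissibleSystem G}
    (hf : f.toFun = G.treeField N par X₀ I₀) {R C : Set V} (haC : a ∈ C) (haR : a ∉ R)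
    (hR : ∀ j ∈ R, j ∈ C ∨ j ∉ N) (hCR : Nonempty (C ≃ R)) (hCι : ∀ j ∈ R, j ≠ G.input)
    (hCN : C ⊆ N) :
    f.BlockDetVanishes X₀ I₀ R C := by
  classical
  obtain ⟨e⟩ := hCR
  refine ⟨e, ?_⟩
  let D : Set V := {j | Relation.ReflTransGen (fun u v => v ∈ C ∧ v ≠ a ∧ par v = u) a j}
  have hDC : D ⊆ C := by
    intro j hj
    rcases Relation.ReflTransGen.cases_tail hj with h | ⟨u, -, h⟩
    · exact h ▸ haC
    · exact h.1
  have haD : a ∈ D := Relation.ReflTransGen.refl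
  have hDpar : ∀ j ∈ C, j ≠ a → (j ∈ D ↔ par j ∈ D) := by
    intro j hj hja
    constructor
    · intro h
      rcases Relation.ReflTransGen.cases_tail h with h | ⟨u, hu, h⟩
      · exact absurd h hja
      · rw [h.2.2]; exact hu
    · intro h
      exact Relation.ReflTransGen.tail h ⟨hj, hja, rfl⟩
  have key : ∀ j ∈ R, (stateJacobian f.toFun (X₀, I₀) *ᵥ D.indicator 1) j = 0 := by
    intro j hj
    have hja : j ≠ a := by rintro rfl; exact haR hj
    rw [hf, treeField_mulVec]
    rcases hR j hj with hjC | hjN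
    · rw [Set.indicator_of_mem (show j ∈ {j | j ∈ N ∧ j ≠ G.input} from ⟨hCN hjC, hCι j hj⟩)]
      simp only [Set.indicator_apply, hDpar j hjC hja, Pi.one_apply]
      ring
    · have : j ∉ D := fun h => hjN (hCN (hDC h))
      simp [this, hjN]
  refine exists_mulVec_eq_zero_iff.1 ⟨fun l : C => D.indicator 1 (l : V), ?_, ?_⟩
  · refine Function.ne_iff.2 ⟨⟨a, haC⟩, ?_⟩
    simp [haD]
  · ext i
    rw [Pi.zero_apply, ← key (e i) (e i).2]
    refine Fintype.sum_of_injective Subtype.val Subtype.val_injective _ _ (fun l hl => ?_)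
      (fun l => rfl)
    have : l ∉ D := fun h => hl ⟨⟨l, hDC h⟩, rfl⟩
    simp [this]

end TreeSystem

/-! ### Nodes that are not induced -/

section NotInduced

variable {V : Type*} [Fintype V] [DecidableEq V] {G : IONetwork V} {a b κ : V}

open Matrix

/-- In the tree system for `avoiding b`, the block of the structural subnetwork before `b` is
singular, while the rate of change of the nodes in `avoiding b` does not vanish. This persists in
a neighbourhood of the tree system. -/
theorem Consecutive.not_induces (hab : G.Consecutive a b) (hG : G.IsCore) (hκ : κ ∈ G.avoiding b)
    (X₀ : V → ℝ) (I₀ : ℝ) : ¬ G.Induces X₀ I₀ (G.structuralSubnetwork a b) κ := by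
  classical
  rintro ⟨R, C, hRC, hU, U, -, hdense, hhom⟩
  obtain ⟨hR, hC⟩ := hRC.eq_of_union_eq hG hab hU
  have ha := hab.1
  have hb := hab.2.1
  have hbi : b ≠ G.input := by rintro rfl; simp [avoiding_input] at hκ
  have hι : G.input ∈ G.avoiding b := input_mem_avoiding hbi
  have haug := notMem_augmentedSubnetwork_left ha hb
  have hne : a ≠ b := by
    rintro rfl
    exact self_notMem_avoiding (consecutive_iff.1 hab).2.2.1
  obtain ⟨par, d, htree⟩ := exists_spanningTree hbi
  obtain ⟨f, hf⟩ := exists_treeSystem htree X₀ I₀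
  have hhyp := isHyperbolicEquilibrium_of_treeField hf hι htree
  let X : ℝ → V → ℝ := fun t j => X₀ j + (t - I₀) * if j ∈ G.avoiding b then 1 else 0
  have hX0 : X I₀ = X₀ := by ext j; simp [X]
  have hXj : ∀ j, HasDerivAt (fun t => X t j) (if j ∈ G.avoiding b then 1 else 0) I₀ := by
    intro j
    have := (((hasDerivAt_id I₀).sub_const I₀).mul_const
      (if j ∈ G.avoiding b then (1 : ℝ) else 0)).const_add (X₀ j)
    rwa [one_mul] at this
  have hXd : DifferentiableAt ℝ X I₀ := (hasDerivAt_pi.2 hXj).differentiableAt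
  have hXe : ∀ᶠ t in nhds I₀, f.toFun (X t, t) = 0 := Filter.Eventually.of_forall fun t => by
    rw [hf]; exact treeField_family hι htree t
  have ho : f.IsHomeostatic X₀ I₀ G.output :=
    ⟨X, hX0, hXd, hXe, by rw [(hXj _).deriv, if_neg hb.output_notMem]⟩
  have hdet : f.BlockDetVanishes X₀ I₀ R C := by
    obtain ⟨p, hp⟩ := hG.exists_isIOPath
    have himage := hab.image_insert_augmentedSubnetwork hG hp
    refine blockDetVanishes_of_treeField (a := a) hf (hC ▸ .inl rfl) ?_ ?_ ?_ ?_ ?_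
    · rw [hR]; rintro (h | h)
      · exact hne h
      · exact haug h
    · rw [hR, hC]
      rintro j (rfl | hj)
      · exact .inr self_notMem_avoiding
      · exact .inl (.inr hj)
    · rw [hR, hC, ← himage]
      exact ⟨p.formPerm.image _⟩
    · intro j hj
      rw [hR, ← himage] at hj
      obtain ⟨l, hl, rfl⟩ := hj
      refine hp.isMatching.apply_ne_input ?_
      rintro rfl
      exact hb.output_notMem (hab.insert_augmentedSubnetwork_subset hG hl)
    · rw [hC]; exact hab.insert_augmentedSubnetwork_subset hG
  have hrate : f.rateNumerator X₀ I₀ κ ≠ 0 := by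
    rw [AdmissibleSystem.rateNumerator_eq (AdmissibleSystem.mulVec_deriv_add hX0 hXd hXe),
      ← AdmissibleSystem.deriv_apply hXd, (hXj κ).deriv, if_pos hκ]
    simpa using hhyp.det_ne_zero
  obtain ⟨g, hg, hgU⟩ := hdense.inter_open_nonempty
    {g : inducingSystems G X₀ I₀ R C | g.1.rateNumerator X₀ I₀ κ ≠ 0}
    (isOpen_ne_fun ((AdmissibleSystem.continuous_rateNumerator X₀ I₀ κ).comp
      continuous_subtype_val) continuous_const) ⟨⟨f, hhyp, ho, hdet⟩, hrate⟩
  exact hg (hhom g hgU).rateNumerator_eq_zero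

end NotInduced

end IONetwork

theorem theorem2p16 {V : Type*} [Fintype V] [DecidableEq V] (G : IONetwork V) (hG : G.IsCore)
    (ρ ρ' : V) (hL : G.Consecutive ρ ρ') (A : Set V) (hA : G.IsAppendageComponent A)
    (X₀ : V → ℝ) (I₀ : ℝ) :
    (∃! W : IONetwork.StructNode G, G.IsVmin A W) ∧
      ∀ W : IONetwork.StructNode G, G.IsVmin A W →
        (G.InducesSet X₀ I₀ (G.structuralSubnetwork ρ ρ') A ↔
          G.StrictlyDownstream (IONetwork.StructNode.backbone ρ ρ' hL) W) := by
  refine ⟨hG.existsUnique_isVmin hA, fun W hW => ?_⟩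
  rw [hW.strictlyDownstream_iff hG hA hL]
  exact ⟨fun h κ hκ hκb => hL.not_induces hG hκb X₀ I₀ (h κ hκ),
    fun h κ hκ => hL.induces hG (h κ hκ) X₀ I₀⟩
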